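/- Let $(p_n)_{n\ge 1}$ be a sequence in $(0,1)$ with $np_n/\log n\to\infty$ and $n(1-p_n)\to\infty$ as $n\to\infty$. For each $n$ let $X_{n,1},\dots,X_{n,n+1}$ be i.i.d. $\mathrm{Bin}(n-1,p_n)$ random variables and let $Z_{ij}=Z_{ji}$, $1\le i<j\le n+1$, be i.i.d. $\mathrm{Ber}(p_n)$ random variables that are independent of $(X_{n,i})_i$. Put $$\mu_n=\mathbb E\Big[\frac1{X_{n,1}+1}\Big],\qquad h_n(x,y)=\frac{1}{(x+1)(y+1)}-\mu_n^2,\qquad V_n=\sum_{1\le i<j\le n+1}Z_{ij}\,h_n(X_{n,i},X_{n,j}),$$ and, with $\Phi_n(i,j)=Z_{ij}h_n(X_{n,i},X_{n,j})$ and $\Psi^{(n)}_j(i)=\mathbb E[\Phi_n(i,j)\mid X_{n,i},Z_{ij}]$, $$\beta_n^2=\mathbb E[\Phi_n(1,2)^2],\qquad \gamma_n^2=\mathbb E\big[\Psi^{(n)}_2(1)^2\big],\qquad \theta_n=\sqrt{np_n\gamma_n^2+\beta_n^2/2}.$$ Then $\dfrac{V_n}{n\theta_n}$ converges in distribution to a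 standard normal random variable as $n\to\infty$. -/

import Mathlib

open MeasureTheory ProbabilityTheory Filter

namespace RandomUStat

/-- `μ_n = 𝔼[1 / (X + 1)]` for a `Bin(n - 1, p)`-distributed random variable `X`. -/
noncomputable def mu (n : ℕ) (p : unitInterval) : ℝ :=
  ∫ x : ℝ, 1 / (x + 1) ∂Bin(ℝ, n - 1, p)

/-- The kernel `h_n(x, y) = 1 / ((x + 1) (y + 1)) - μ_n²`. -/
noncomputable def kernel (n : ℕ) (p : unitInterval) (x y : ℝ) : ℝ :=
  1 / ((x + 1) * (y + 1)) - mu n p ^ 2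

section Array

variable {Ω : Type*} [MeasurableSpace Ω]

/-- `Φ_n(i, j) = Z_{ij} h_n(X_i, X_j)`. The variables `Z` are indexed by unordered pairs, so that
`Z_{ij} = Z_{ji}`; the `n + 1` vertices `1, …, n + 1` are the elements of `Fin (n + 1)`. -/
noncomputable def Phi (n : ℕ) (p : unitInterval) (X : Fin (n + 1) → Ω → ℝ)
    (Z : Sym2 (Fin (n + 1)) → Ω → ℝ) (i j : Fin (n + 1)) (ω : Ω) : ℝ :=
  Z s(i, j) ω * kernel n p (X i ω) (X j ω)

/-- `Ψ_j(i) = 𝔼[Φ_n(i, j) | X_i, Z_{ij}]`. -/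
noncomputable def Psi (P : Measure Ω) (n : ℕ) (p : unitInterval) (X : Fin (n + 1) → Ω → ℝ)
    (Z : Sym2 (Fin (n + 1)) → Ω → ℝ) (j i : Fin (n + 1)) : Ω → ℝ :=
  P[Phi n p X Z i j |
    MeasurableSpace.comap (fun ω ↦ (X i ω, Z s(i, j) ω)) inferInstance]

/-- `β_n² = 𝔼[Φ_n(1, 2)²]`; the vertices `1, 2` are `0, 1 : Fin (n + 1)`
(two distinct vertices as soon as `n ≥ 1`). -/
noncomputable def betaSq (P : Measure Ω) (n : ℕ) (p : unitInterval) (X : Fin (n + 1) → Ω → ℝ)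
    (Z : Sym2 (Fin (n + 1)) → Ω → ℝ) : ℝ :=
  ∫ ω, Phi n p X Z 0 1 ω ^ 2 ∂P

/-- `γ_n² = 𝔼[Ψ_2(1)²]`. -/
noncomputable def gammaSq (P : Measure Ω) (n : ℕ) (p : unitInterval) (X : Fin (n + 1) → Ω → ℝ)
    (Z : Sym2 (Fin (n + 1)) → Ω → ℝ) : ℝ :=
  ∫ ω, Psi P n p X Z 1 0 ω ^ 2 ∂P

/-- `θ_n`, the nonnegative root of `θ_n² = n p_n γ_n² + β_n² / 2`. -/
noncomputable def theta (P : Measure Ω) (n : ℕ) (p : unitInterval) (X : Fin (n + 1) → Ω → ℝ)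
    (Z : Sym2 (Fin (n + 1)) → Ω → ℝ) : ℝ :=
  Real.sqrt (n * p * gammaSq P n p X Z + betaSq P n p X Z / 2)

/-- `V_n = ∑_{1 ≤ i < j ≤ n + 1} Z_{ij} h_n(X_i, X_j)`. -/
noncomputable def V (n : ℕ) (p : unitInterval) (X : Fin (n + 1) → Ω → ℝ)
    (Z : Sym2 (Fin (n + 1)) → Ω → ℝ) (ω : Ω) : ℝ :=
  ∑ i : Fin (n + 1), ∑ j ∈ Finset.Ioi i, Z s(i, j) ω * kernel n p (X i ω) (X j ω)

end Array

end RandomUStat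

/-! Put `D_i = 1/(X_i+1) - μ`, with variance `s`, and `r = np`. Hoeffding's decomposition of the
kernel is `h(X_i, X_j) = μ(D_i + D_j) + D_i D_j`. Writing `Z_ij = p + (Z_ij - p)` in its linear part
gives `V = npμ ∑ D_i + R`, where `R` sums `μ(D_i + D_j)(Z_ij - p)` and `Z_ij D_i D_j` over pairs
(`V_eq`). Within each of these two families distinct pairs are orthogonal, so `E R²` is at most the
number of pairs times `p(4μ²s + 2s²)` (`integral_remainder_sq_le`). As `s ≤ 8μ²`, this is `O(1/r)`
relative to the variance of the linear sum.

The normalization matches: `Ψ_2(1) = μ Z_12 D_1`, hence `npγ² = κ²` with `κ = pμ√(ns)`, while `β² ≤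
20κ²/r`. So `θ/κ → 1`, and `V/(nθ)` is within `61/√r` in mean of `∑ D_i/√(ns)`
(`integral_abs_V_div_sub_le`).

What remains is a central limit theorem for an i.i.d. triangular array. Lyapunov's condition needs
`E D⁴ ≤ C s²` with `C` independent of `n` (`integral_centered_inv_pow_four_le_sigmaSq`). Size
biasing bounds inverse moments of a binomial by ordinary ones and yields `E D⁴ = O((1-p)²/r⁶)`;
Cauchy–Schwarz against `X` yields `s ≥ (1-p)/(4r³)`. Both need `r` and `n(1-p)` bounded below. The
L¹ comparison transfers to characteristic functions, and Lévy's theorem concludes. -/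

open scoped Topology

namespace RandomUStat

/-! ### Moments and inverse moments of the binomial law. -/

section Binomial

variable {N : ℕ} {p : unitInterval}

lemma integral_binomial_eq_sum_range (N : ℕ) (p : unitInterval) (f : ℝ → ℝ) :
    ∫ x, f x ∂Bin(ℝ, N, p) = ∑ k ∈ Finset.range (N + 1),
      (N.choose k * (p : ℝ) ^ k * (1 - p) ^ (N - k)) * f k := by
  rw [integral_map_cast_binomial]
  have : Finset.Iic N = Finset.range (N + 1) := by ext; simp
  rw [this]
  simp

/-- Size biasing of the binomial distribution. -/
lemma integral_binomial_sizeBias (N : ℕ) (p : unitInterval) (f : ℝ → ℝ) :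
    ∫ x, x * f (x - 1) ∂Bin(ℝ, N + 1, p) = p * (N + 1) * ∫ x, f x ∂Bin(ℝ, N, p) := by
  rw [integral_binomial_eq_sum_range, integral_binomial_eq_sum_range, Finset.sum_range_succ',
    Finset.mul_sum]
  simp only [Nat.cast_zero, zero_mul, mul_zero, add_zero]
  refine Finset.sum_congr rfl fun k _ ↦ ?_
  have h : ((N : ℝ) + 1) * N.choose k = (N + 1).choose (k + 1) * (k + 1) := by
    exact_mod_cast Nat.add_one_mul_choose_eq N k
  have h' : N + 1 - (k + 1) = N - k := by omega
  rw [h']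
  push_cast
  rw [add_sub_cancel_right, pow_succ]
  linear_combination -(p : ℝ) ^ k * p * (1 - p) ^ (N - k) * f k * h

/-- Condition on one coin; on the weights this is Pascal's rule. It drives the inductions for the
central moments. -/
lemma integral_binomial_succ (N : ℕ) (p : unitInterval) (f : ℝ → ℝ) :
    ∫ x, f x ∂Bin(ℝ, N + 1, p) =
      (1 - p) * ∫ x, f x ∂Bin(ℝ, N, p) + p * ∫ x, f (x + 1) ∂Bin(ℝ, N, p) := by
  simp only [integral_binomial_eq_sum_range]
  have h1 : ∑ k ∈ Finset.range (N + 1 + 1),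
      (N.choose k * (p : ℝ) ^ k * (1 - p) ^ (N + 1 - k)) * f k =
      (1 - p) * ∑ k ∈ Finset.range (N + 1),
        (N.choose k * (p : ℝ) ^ k * (1 - p) ^ (N - k)) * f k := by
    rw [Finset.sum_range_succ, Nat.choose_succ_self, Finset.mul_sum]
    simp only [Nat.cast_zero, zero_mul, add_zero]
    refine Finset.sum_congr rfl fun k hk ↦ ?_
    have : N + 1 - k = (N - k) + 1 := by
      have := Finset.mem_range.1 hk
      omega
    rw [this, pow_succ]
    ring
  rw [← h1, Finset.sum_range_succ' _ (N + 1), Finset.sum_range_succ' _ (N + 1), Finset.mul_sum,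
    add_right_comm, ← Finset.sum_add_distrib]
  congr 1
  · refine Finset.sum_congr rfl fun k _ ↦ ?_
    have h' : N + 1 - (k + 1) = N - k := by omega
    rw [h', Nat.choose_succ_succ]
    push_cast
    ring
  · simp

lemma integral_binomial_sub_mean (N : ℕ) (p : unitInterval) :
    ∫ x, (x - N * p) ∂Bin(ℝ, N, p) = 0 := by
  induction N with
  | zero => simp
  | succ N ih =>
    rw [integral_binomial_succ, ← integral_const_mul, ← integral_const_mul,
      ← integral_add (integrable_map_cast_binomial _) (integrable_map_cast_binomial _), ← ih]
    congr 1 with x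
    push_cast
    ring

lemma integral_binomial_sub_mean_sq (N : ℕ) (p : unitInterval) :
    ∫ x, (x - N * p) ^ 2 ∂Bin(ℝ, N, p) = N * p * (1 - p) := by
  induction N with
  | zero => simp
  | succ N ih =>
    rw [integral_binomial_succ, ← integral_const_mul, ← integral_const_mul,
      ← integral_add (integrable_map_cast_binomial _) (integrable_map_cast_binomial _)]
    have : ∀ x : ℝ, (1 - (p : ℝ)) * (x - ((N + 1 : ℕ) : ℝ) * p) ^ 2 +
        p * (x + 1 - ((N + 1 : ℕ) : ℝ) * p) ^ 2 = (x - N * p) ^ 2 + p * (1 - p) := by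
      intro x
      push_cast
      ring
    simp_rw [this]
    rw [integral_add (integrable_map_cast_binomial _) (integrable_map_cast_binomial _), ih]
    simp
    ring

lemma integral_binomial_sub_mean_pow_four_le (N : ℕ) (p : unitInterval) :
    ∫ x, (x - N * p) ^ 4 ∂Bin(ℝ, N, p) ≤ N * p * (1 - p) + 3 * (N * p * (1 - p)) ^ 2 := by
  induction N with
  | zero => simp
  | succ N ih =>
    rw [integral_binomial_succ, ← integral_const_mul, ← integral_const_mul,
      ← integral_add (integrable_map_cast_binomial _) (integrable_map_cast_binomial _)]
    -- The coefficients are the central moments of one coin; the term linear in `x - N * p`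
    -- integrates to zero.
    have h : ∀ x : ℝ, (1 - (p : ℝ)) * (x - ((N + 1 : ℕ) : ℝ) * p) ^ 4 +
        p * (x + 1 - ((N + 1 : ℕ) : ℝ) * p) ^ 4 = (x - N * p) ^ 4 + (6 * p * (1 - p) *
        (x - N * p) ^ 2 + (4 * p * (1 - p) * (1 - 2 * p) * (x - N * p) +
        p * (1 - p) * (1 - 3 * p * (1 - p)))) := by
      intro x
      push_cast
      ring
    simp_rw [h]
    rw [integral_add (integrable_map_cast_binomial _) (integrable_map_cast_binomial _),
      integral_add (integrable_map_cast_binomial _) (integrable_map_cast_binomial _),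
      integral_add (integrable_map_cast_binomial _) (integrable_map_cast_binomial _),
      integral_const_mul, integral_const_mul, integral_binomial_sub_mean,
      integral_binomial_sub_mean_sq]
    simp only [integral_const, probReal_univ, smul_eq_mul, one_mul]
    have hp : (0 : ℝ) ≤ p * (1 - p) := mul_nonneg p.2.1 (sub_nonneg.2 p.2.2)
    push_cast
    nlinarith [sq_nonneg ((p : ℝ) * (1 - p))]

lemma ae_binomial_nonneg (N : ℕ) (p : unitInterval) : ∀ᵐ x ∂Bin(ℝ, N, p), 0 ≤ x := by
  rw [ae_map_iff (by fun_prop) measurableSet_Ici]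
  exact ae_of_all _ fun k ↦ Nat.cast_nonneg k

lemma integral_binomial_mono {f g : ℝ → ℝ} (h : ∀ x, 0 ≤ x → f x ≤ g x) :
    ∫ x, f x ∂Bin(ℝ, N, p) ≤ ∫ x, g x ∂Bin(ℝ, N, p) :=
  integral_mono_ae (integrable_map_cast_binomial _) (integrable_map_cast_binomial _)
    ((ae_binomial_nonneg N p).mono h)

/-- Dividing by `x + 1` costs a factor `1 / (p (N + 1))` and one more coin. -/
lemma integral_binomial_div_succ_le (hp : 0 < (p : ℝ)) (g : ℝ → ℝ) (hg : 0 ≤ g (-1)) :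
    ∫ x, g x / (x + 1) ∂Bin(ℝ, N, p) ≤
      (∫ x, g (x - 1) ∂Bin(ℝ, N + 1, p)) / ((p : ℝ) * (N + 1)) := by
  rw [le_div_iff₀' (by positivity), ← integral_binomial_sizeBias N p fun x ↦ g x / (x + 1)]
  refine integral_binomial_mono fun x hx ↦ ?_
  -- The atom at 0 is lost by size biasing: it contributes 0 on the left and `g (-1) ≥ 0` on the
  -- right.
  rcases hx.eq_or_lt with rfl | hx
  · simpa using hg
  · rw [sub_add_cancel, mul_div_cancel₀ _ hx.ne']

/-- Since `x + k ≤ k (x + 1)`, the fourth power `(x + 1)⁻⁴` is at most `24 /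
((x+1)(x+2)(x+3)(x+4))`. Each of these factors is removed by one size biasing, which adds a coin and
shifts `x` by 1. -/
lemma integral_binomial_pow_four_div_le (hp : 0 < (p : ℝ)) (c : ℝ) :
    ∫ x, (x - c) ^ 4 / (x + 1) ^ 4 ∂Bin(ℝ, N, p) ≤
      24 * (∫ x, (x - 4 - c) ^ 4 ∂Bin(ℝ, N + 4, p)) / ((p : ℝ) * (N + 1)) ^ 4 := by
  have h0 : ∫ x, (x - c) ^ 4 / (x + 1) ^ 4 ∂Bin(ℝ, N, p) ≤
      ∫ x, (24 * (x - c) ^ 4 / ((x + 2) * (x + 3) * (x + 4))) / (x + 1) ∂Bin(ℝ, N, p) := by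
    refine integral_binomial_mono fun x hx ↦ ?_
    rw [div_div, div_le_div_iff₀ (by positivity) (by positivity)]
    have h : (x + 2) * (x + 3) * (x + 4) * (x + 1) ≤ 24 * (x + 1) ^ 4 := by
      have : 0 ≤ x ^ 2 := by positivity
      have : 0 ≤ x ^ 3 := by positivity
      have : 0 ≤ x ^ 4 := by positivity
      nlinarith
    have h4 : 0 ≤ (x - c) ^ 4 := by positivity
    nlinarith [mul_le_mul_of_nonneg_left h h4]
  have h1 := integral_binomial_div_succ_le (N := N) hp
    (fun x ↦ 24 * (x - c) ^ 4 / ((x + 2) * (x + 3) * (x + 4))) (by norm_num; positivity)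
  have h2 := integral_binomial_div_succ_le (N := N + 1) hp
    (fun x ↦ 24 * (x - 1 - c) ^ 4 / ((x + 2) * (x + 3))) (by norm_num; positivity)
  have h3 := integral_binomial_div_succ_le (N := N + 2) hp
    (fun x ↦ 24 * (x - 2 - c) ^ 4 / (x + 2)) (by norm_num; positivity)
  have h4 := integral_binomial_div_succ_le (N := N + 3) hp
    (fun x ↦ 24 * (x - 3 - c) ^ 4) (by norm_num; positivity)
  have e1 : ∫ x, 24 * (x - 1 - c) ^ 4 / ((x - 1 + 2) * (x - 1 + 3) * (x - 1 + 4))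
      ∂Bin(ℝ, N + 1, p) =
      ∫ x, (24 * (x - 1 - c) ^ 4 / ((x + 2) * (x + 3))) / (x + 1) ∂Bin(ℝ, N + 1, p) := by
    congr 1 with x
    rw [div_div]
    congr 1
    ring
  have e2 : ∫ x, 24 * (x - 1 - 1 - c) ^ 4 / ((x - 1 + 2) * (x - 1 + 3)) ∂Bin(ℝ, N + 1 + 1, p) =
      ∫ x, (24 * (x - 2 - c) ^ 4 / (x + 2)) / (x + 1) ∂Bin(ℝ, N + 2, p) := by
    congr 1 with x
    rw [div_div]
    congr 1 <;> ring
  have e3 : ∫ x, 24 * (x - 1 - 2 - c) ^ 4 / (x - 1 + 2) ∂Bin(ℝ, N + 2 + 1, p) =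
      ∫ x, (24 * (x - 3 - c) ^ 4) / (x + 1) ∂Bin(ℝ, N + 3, p) := by
    congr 1 with x
    congr 1 <;> ring
  have e4 : ∫ x, 24 * (x - 1 - 3 - c) ^ 4 ∂Bin(ℝ, N + 3 + 1, p) =
      24 * ∫ x, (x - 4 - c) ^ 4 ∂Bin(ℝ, N + 4, p) := by
    rw [← integral_const_mul]
    congr 1 with x
    ring
  rw [e1] at h1
  rw [e2] at h2
  rw [e3] at h3
  rw [e4] at h4
  set K := 24 * ∫ x, (x - 4 - c) ^ 4 ∂Bin(ℝ, N + 4, p) with hK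
  have hK0 : 0 ≤ K := mul_nonneg (by norm_num) (integral_nonneg fun x ↦ by positivity)
  have hr : 0 < (p : ℝ) * (N + 1) := by positivity
  have key : ∀ (j : ℕ) {a b : ℝ}, a ≤ b / (p * (((N + j : ℕ) : ℝ) + 1)) → 0 ≤ b →
      a ≤ b / (p * (N + 1)) := by
    intro j a b h hb
    refine h.trans (div_le_div_of_nonneg_left hb hr ?_)
    push_cast
    have : (0 : ℝ) ≤ p * j := by positivity
    nlinarith
  have h4' := key 3 h4 hK0
  have h3' := (key 2 h3 (integral_nonneg_of_ae ((ae_binomial_nonneg _ p).mono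
    fun x hx ↦ by simp only [Pi.zero_apply] at hx ⊢; positivity))).trans
    (div_le_div_of_nonneg_right h4' hr.le)
  have h2' := (key 1 h2 (integral_nonneg_of_ae ((ae_binomial_nonneg _ p).mono
    fun x hx ↦ by simp only [Pi.zero_apply] at hx ⊢; positivity))).trans
    (div_le_div_of_nonneg_right h3' hr.le)
  have h1' := h1.trans (div_le_div_of_nonneg_right h2' hr.le)
  refine (h0.trans h1').trans_eq ?_
  rw [div_div, div_div, div_div]
  congr 1
  ring

/-- Size biasing turns the left side into the probability that `N + 1` coins show at least one
success. -/
lemma mul_integral_inv_succ_eq (N : ℕ) (p : unitInterval) :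
    (p : ℝ) * (N + 1) * ∫ x : ℝ, 1 / (x + 1) ∂Bin(ℝ, N, p) = 1 - (1 - (p : ℝ)) ^ (N + 1) := by
  rw [← integral_binomial_sizeBias N p fun x ↦ 1 / (x + 1), integral_binomial_eq_sum_range,
    Finset.sum_range_succ']
  have h : ∑ k ∈ Finset.range (N + 1 + 1),
      ((N + 1).choose k * (p : ℝ) ^ k * (1 - p) ^ (N + 1 - k)) = 1 := by
    have := add_pow (p : ℝ) (1 - p) (N + 1)
    rw [add_sub_cancel, one_pow] at this
    exact (Finset.sum_congr rfl fun k _ ↦ by ring).trans this.symm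
  rw [Finset.sum_range_succ'] at h
  rw [eq_sub_iff_add_eq]
  refine Eq.trans ?_ h
  congr 1
  · simp only [Nat.cast_zero, zero_mul, mul_zero, add_zero]
    refine Finset.sum_congr rfl fun k _ ↦ ?_
    have : ((k + 1 : ℕ) : ℝ) ≠ 0 := by positivity
    rw [sub_add_cancel, mul_one_div_cancel this, mul_one]
  · simp

lemma integral_inv_succ_sq_le (hp : 0 < (p : ℝ)) :
    ∫ x : ℝ, (1 / (x + 1)) ^ 2 ∂Bin(ℝ, N, p) ≤ 2 / ((p : ℝ) * (N + 1)) ^ 2 := by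
  have h0 : ∫ x : ℝ, (1 / (x + 1)) ^ 2 ∂Bin(ℝ, N, p) ≤
      ∫ x : ℝ, (2 / (x + 2)) / (x + 1) ∂Bin(ℝ, N, p) := by
    refine integral_binomial_mono fun x hx ↦ ?_
    rw [div_div, div_pow, div_le_div_iff₀ (by positivity) (by positivity)]
    nlinarith
  have h1 := integral_binomial_div_succ_le (N := N) hp (fun x ↦ 2 / (x + 2)) (by norm_num)
  have h2 := integral_binomial_div_succ_le (N := N + 1) hp (fun x ↦ 2) (by norm_num)
  have e1 : ∫ x : ℝ, 2 / (x - 1 + 2) ∂Bin(ℝ, N + 1, p) =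
      ∫ x : ℝ, 2 / (x + 1) ∂Bin(ℝ, N + 1, p) := by
    congr 1 with x
    congr 1
    ring
  rw [e1] at h1
  simp only [integral_const, probReal_univ, smul_eq_mul, one_mul] at h2
  have hr : 0 < (p : ℝ) * (N + 1) := by positivity
  have h2' : ∫ x : ℝ, 2 / (x + 1) ∂Bin(ℝ, N + 1, p) ≤ 2 / ((p : ℝ) * (N + 1)) := by
    refine h2.trans (div_le_div_of_nonneg_left (by norm_num) hr ?_)
    push_cast
    nlinarith
  refine (h0.trans (h1.trans (div_le_div_of_nonneg_right h2' hr.le))).trans_eq ?_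
  rw [div_div]
  congr 1
  ring

end Binomial

/-! ### Mean, variance and fourth central moment of 1/(X+1). -/

section InverseMoments

/-- The variance of `1 / (X + 1)` for a `Bin(n - 1, p)`-distributed random variable `X`. -/
noncomputable def sigmaSq (n : ℕ) (p : unitInterval) : ℝ :=
  ∫ x : ℝ, (1 / (x + 1) - mu n p) ^ 2 ∂Bin(ℝ, n - 1, p)

variable {n : ℕ} {p : unitInterval}

lemma integral_centered_inv (n : ℕ) (p : unitInterval) :
    ∫ x : ℝ, (1 / (x + 1) - mu n p) ∂Bin(ℝ, n - 1, p) = 0 := by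
  rw [integral_sub (integrable_map_cast_binomial _) (integrable_map_cast_binomial _), ← mu]
  simp

lemma mul_mu_eq (hn : 1 ≤ n) (p : unitInterval) :
    (n : ℝ) * p * mu n p = 1 - (1 - (p : ℝ)) ^ n := by
  have h := mul_integral_inv_succ_eq (n - 1) p
  rw [← mu, Nat.sub_add_cancel hn, Nat.cast_sub hn] at h
  rw [← h]
  push_cast
  ring

lemma one_sub_pow_le_exp (p : unitInterval) (k : ℕ) :
    (1 - (p : ℝ)) ^ k ≤ Real.exp (-(k * p)) := by
  rw [show -((k : ℝ) * p) = k * -(p : ℝ) by ring, Real.exp_nat_mul]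
  exact pow_le_pow_left₀ (sub_nonneg.2 p.2.2) (Real.one_sub_le_exp_neg _) k

lemma mu_ge (hn : 1 ≤ n) (hr : 1 ≤ (n : ℝ) * p) : 1 / (2 * ((n : ℝ) * p)) ≤ mu n p := by
  have h := mul_mu_eq hn p
  have h1 := one_sub_pow_le_exp p n
  have h2 : Real.exp (-((n : ℝ) * p)) ≤ 1 / 2 := by
    rw [Real.exp_neg, ← one_div]
    refine div_le_div_of_nonneg_left (by norm_num) (by norm_num) ?_
    linarith [Real.add_one_le_exp ((n : ℝ) * p)]
  rw [div_le_iff₀ (by linarith)]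
  linarith

lemma sigmaSq_le (hn : 1 ≤ n) (hp : 0 < (p : ℝ)) : sigmaSq n p ≤ 2 / ((n : ℝ) * p) ^ 2 := by
  have h := integral_inv_succ_sq_le (N := n - 1) hp
  have hc : (p : ℝ) * (((n - 1 : ℕ) : ℝ) + 1) = n * p := by
    rw [Nat.cast_sub hn]
    push_cast
    ring
  rw [hc] at h
  refine le_trans ?_ h
  have e : ∀ x : ℝ, (1 / (x + 1) - mu n p) ^ 2 =
      (1 / (x + 1)) ^ 2 - (2 * mu n p * (1 / (x + 1)) - mu n p ^ 2) := fun x ↦ by ring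
  simp_rw [sigmaSq, e]
  rw [integral_sub (integrable_map_cast_binomial _) (integrable_map_cast_binomial _),
    integral_sub (integrable_map_cast_binomial _) (integrable_map_cast_binomial _),
    integral_const_mul, ← mu]
  simp only [integral_const, probReal_univ, smul_eq_mul, one_mul]
  nlinarith [sq_nonneg (mu n p)]

/-- The covariance of `X` and `1/(X+1)` is explicit because `(x - m)/(x + 1) = 1 - (m + 1)/(x + 1)`.
-/
lemma integral_cov_inv (n : ℕ) (p : unitInterval) :
    ∫ x : ℝ, (x - ((n - 1 : ℕ) : ℝ) * p) * (1 / (x + 1) - mu n p) ∂Bin(ℝ, n - 1, p) =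
      1 - (((n - 1 : ℕ) : ℝ) * p + 1) * mu n p := by
  set m := ((n - 1 : ℕ) : ℝ) * p with hm
  have e : ∫ x : ℝ, (x - m) * (1 / (x + 1) - mu n p) ∂Bin(ℝ, n - 1, p) =
      ∫ x : ℝ, (1 - ((m + 1) * (1 / (x + 1)) + mu n p * (x - m))) ∂Bin(ℝ, n - 1, p) := by
    refine integral_congr_ae ((ae_binomial_nonneg _ p).mono fun x hx ↦ ?_)
    have : x + 1 ≠ 0 := by positivity
    field_simp
    ring
  rw [e, integral_sub (integrable_map_cast_binomial _) (integrable_map_cast_binomial _),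
    integral_add (integrable_map_cast_binomial _) (integrable_map_cast_binomial _),
    integral_const_mul, integral_const_mul, hm, integral_binomial_sub_mean, ← mu]
  simp

/-- Cauchy–Schwarz: the variance of `1/(X+1)` is at least `c² / Var X`, with `c` its covariance with
`X`. Up to an exponentially small term, `np · c` equals `-(1 - p)`. -/
lemma le_sigmaSq (hn : 1 ≤ n) (hp1 : (p : ℝ) < 1) (hm : 3 ≤ ((n - 1 : ℕ) : ℝ) * p) :
    (1 - p) / (4 * ((n : ℝ) * p) ^ 3) ≤ sigmaSq n p := by
  set m := ((n - 1 : ℕ) : ℝ) * p with hm_def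
  set c := 1 - (m + 1) * mu n p with hc
  have hq : 0 < 1 - (p : ℝ) := sub_pos.2 hp1
  have hr : (n : ℝ) * p = m + p := by
    rw [hm_def, Nat.cast_sub hn]
    push_cast
    ring
  have hp0 : 0 ≤ (p : ℝ) := p.2.1
  have hrc : (n : ℝ) * p * c ≤ -((1 - p) / 2) := by
    have h1 := mul_mu_eq hn p
    have h2 : (m + 1) * (1 - (p : ℝ)) ^ (n - 1) ≤ 1 / 2 := by
      have h3 := one_sub_pow_le_exp p (n - 1)
      rw [← hm_def, Real.exp_neg] at h3
      have h4 := Real.quadratic_le_exp_of_nonneg (x := m) (by linarith)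
      -- This is where `m ≥ 3` enters: it gives `m²/2 ≥ m + 1`.
      have h5 : 2 * (m + 1) ≤ Real.exp m := by nlinarith
      calc (m + 1) * (1 - (p : ℝ)) ^ (n - 1) ≤ (m + 1) * (Real.exp m)⁻¹ := by gcongr
        _ ≤ 1 / 2 := by
          rw [← div_eq_mul_inv, div_le_div_iff₀ (Real.exp_pos _) (by norm_num)]
          linarith
    have h6 : (1 - (p : ℝ)) ^ n = (1 - p) ^ (n - 1) * (1 - p) := by
      rw [← pow_succ, Nat.sub_add_cancel hn]
    have h7 : (n : ℝ) * p * c = -(1 - p) + (m + 1) * (1 - (p : ℝ)) ^ (n - 1) * (1 - p) := by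
      rw [hc]
      linear_combination -(m + 1) * h1 + hr + (m + 1) * h6
    rw [h7]
    nlinarith
  have hrpos : 0 < (n : ℝ) * p := by linarith
  have hv : 0 < m * (1 - p) := mul_pos (by linarith) hq
  have hσ : c ^ 2 / (m * (1 - p)) ≤ sigmaSq n p := by
    -- The regression coefficient of `1/(X+1)` on `X`; the residual has nonnegative second moment.
    set l := c / (m * (1 - p)) with hl
    have e : ∀ x : ℝ, (1 / (x + 1) - mu n p - l * (x - m)) ^ 2 =
        (1 / (x + 1) - mu n p) ^ 2 + (l ^ 2 * (x - m) ^ 2 -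
          2 * l * ((x - m) * (1 / (x + 1) - mu n p))) := fun x ↦ by ring
    have h0 : 0 ≤ ∫ x : ℝ, (1 / (x + 1) - mu n p - l * (x - m)) ^ 2 ∂Bin(ℝ, n - 1, p) :=
      integral_nonneg fun x ↦ sq_nonneg _
    simp_rw [e] at h0
    rw [integral_add (integrable_map_cast_binomial _) (integrable_map_cast_binomial _),
      integral_sub (integrable_map_cast_binomial _) (integrable_map_cast_binomial _),
      integral_const_mul, integral_const_mul, integral_cov_inv, hm_def,
      integral_binomial_sub_mean_sq, ← hm_def, ← hc, ← sigmaSq] at h0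
    have h1 : l * (m * (1 - p)) = c := div_mul_cancel₀ _ hv.ne'
    have h2 : c ^ 2 / (m * (1 - p)) = l * c := by
      rw [hl]
      ring
    have h3 : l ^ 2 * (m * (1 - p)) = l * c := by rw [sq, mul_assoc, h1]
    rw [h2]
    linarith
  refine le_trans ?_ hσ
  rw [div_le_div_iff₀ (by positivity) hv]
  have h8 : (1 - (p : ℝ)) ^ 2 / 4 ≤ ((n : ℝ) * p * c) ^ 2 := by nlinarith
  calc (1 - (p : ℝ)) * (m * (1 - p)) = m * (1 - p) ^ 2 := by ring
    _ ≤ (n * p) * (4 * ((n : ℝ) * p * c) ^ 2) := by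
      apply mul_le_mul (by linarith) (by linarith) (by positivity) hrpos.le
    _ = c ^ 2 * (4 * ((n : ℝ) * p) ^ 3) := by ring

/-- Centering at `1/(m + 1)` instead of `μ` costs a factor 16 and gives `1/(x+1) - 1/(m+1) = (m -
x)/((x+1)(m+1))`, so the bound reduces to a fourth moment of a binomial near its mean. The condition
`np(1-p) ≥ 1` absorbs lower-order terms into `v²`. -/
lemma integral_centered_inv_pow_four_le (hn : 1 ≤ n) (hp0 : 0 < (p : ℝ))
    (hv : 1 ≤ (n : ℝ) * p * (1 - p)) :
    ∫ x : ℝ, (1 / (x + 1) - mu n p) ^ 4 ∂Bin(ℝ, n - 1, p) ≤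
      10 ^ 6 * (1 - p) ^ 2 / ((n : ℝ) * p) ^ 6 := by
  set m := ((n - 1 : ℕ) : ℝ) * p with hm_def
  set b := mu n p - 1 / (m + 1) with hb
  have hq0 : 0 ≤ 1 - (p : ℝ) := sub_nonneg.2 p.2.2
  have hr : (n : ℝ) * p = m + p := by
    rw [hm_def, Nat.cast_sub hn]
    push_cast
    ring
  have hm0 : 0 ≤ m := by positivity
  have hn0 : (0 : ℝ) < n := by exact_mod_cast hn
  have hrpos : 0 < (n : ℝ) * p := by positivity
  set I := ∫ x : ℝ, (1 / (x + 1) - 1 / (m + 1)) ^ 4 ∂Bin(ℝ, n - 1, p) with hI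
  -- Jensen's inequality, through the tangent line of the fourth power at `b`.
  have hbI : b ^ 4 ≤ I := by
    have e : ∫ x : ℝ, (b ^ 4 + 4 * b ^ 3 * (1 / (x + 1) - mu n p)) ∂Bin(ℝ, n - 1, p) ≤ I := by
      refine integral_binomial_mono fun x _ ↦ ?_
      set a := 1 / (x + 1) - 1 / (m + 1) with ha
      have : 1 / (x + 1) - mu n p = a - b := by rw [ha, hb]; ring
      rw [this]
      nlinarith [mul_nonneg (sq_nonneg (a - b)) (add_nonneg (sq_nonneg (a + b))
        (mul_nonneg (zero_le_two (α := ℝ)) (sq_nonneg b)))]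
    rwa [integral_add (integrable_map_cast_binomial _) (integrable_map_cast_binomial _),
      integral_const_mul, integral_centered_inv, integral_const, probReal_univ, one_smul,
      mul_zero, add_zero] at e
  have h16 : ∫ x : ℝ, (1 / (x + 1) - mu n p) ^ 4 ∂Bin(ℝ, n - 1, p) ≤ 16 * I := by
    have e : ∫ x : ℝ, (1 / (x + 1) - mu n p) ^ 4 ∂Bin(ℝ, n - 1, p) ≤
        ∫ x : ℝ, (8 * (1 / (x + 1) - 1 / (m + 1)) ^ 4 + 8 * b ^ 4) ∂Bin(ℝ, n - 1, p) := by
      refine integral_binomial_mono fun x _ ↦ ?_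
      set a := 1 / (x + 1) - 1 / (m + 1) with ha
      have : 1 / (x + 1) - mu n p = a - b := by rw [ha, hb]; ring
      rw [this]
      have h2 : (a - b) ^ 2 ≤ 2 * (a ^ 2 + b ^ 2) := by nlinarith [sq_nonneg (a + b)]
      have h3 : ((a - b) ^ 2) ^ 2 ≤ (2 * (a ^ 2 + b ^ 2)) ^ 2 :=
        pow_le_pow_left₀ (sq_nonneg _) h2 2
      nlinarith [sq_nonneg (a ^ 2 - b ^ 2)]
    rw [integral_add (integrable_map_cast_binomial _) (integrable_map_cast_binomial _),
      integral_const_mul, integral_const, probReal_univ, one_smul] at e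
    linarith
  have hN : ((n - 1 : ℕ) : ℝ) + 1 = n := by
    rw [Nat.cast_sub hn]
    push_cast
    ring
  set J := ∫ x : ℝ, (x - 4 - m) ^ 4 ∂Bin(ℝ, n - 1 + 4, p) with hJ
  have hIJ : I ≤ 24 * J / ((n : ℝ) * p) ^ 4 / (m + 1) ^ 4 := by
    have h := integral_binomial_pow_four_div_le (N := n - 1) hp0 m
    rw [hN, ← hJ, mul_comm (p : ℝ)] at h
    refine le_trans (le_of_eq ?_) (div_le_div_of_nonneg_right h (by positivity))
    rw [← integral_div]
    refine integral_congr_ae ((ae_binomial_nonneg _ p).mono fun x hx ↦ ?_)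
    have h1 : x + 1 ≠ 0 := by positivity
    have h2 : m + 1 ≠ 0 := by positivity
    dsimp only
    rw [div_sub_div _ _ h1 h2, div_pow, mul_pow, div_div]
    congr 1
    ring
  set v := (n : ℝ) * p * (1 - p) with hv_def
  -- `2464 = 8 (4 + 3·16) + 2048`, from `w ≤ 4v`, `v ≥ 1` and `2048 = 8·4⁴`; the mean of the
  -- enlarged binomial is `m + 4p`, off by `4(1 - p)` from `m + 4`.
  have hJv : J ≤ 2464 * v ^ 2 := by
    have e : J ≤ ∫ x : ℝ, (8 * (x - ((n - 1 + 4 : ℕ) : ℝ) * p) ^ 4 + 2048)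
        ∂Bin(ℝ, n - 1 + 4, p) := by
      refine integral_binomial_mono fun x _ ↦ ?_
      set a := x - ((n - 1 + 4 : ℕ) : ℝ) * p with ha
      set d := 4 * (1 - (p : ℝ)) with hd
      have : x - 4 - m = a - d := by
        rw [ha, hd, hm_def]
        push_cast
        ring
      rw [this]
      have h2 : (a - d) ^ 2 ≤ 2 * (a ^ 2 + d ^ 2) := by nlinarith [sq_nonneg (a + d)]
      have h3 : ((a - d) ^ 2) ^ 2 ≤ (2 * (a ^ 2 + d ^ 2)) ^ 2 :=
        pow_le_pow_left₀ (sq_nonneg _) h2 2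
      have h4 : d ^ 4 ≤ 4 ^ 4 := pow_le_pow_left₀ (by positivity) (by linarith) 4
      nlinarith [sq_nonneg (a ^ 2 - d ^ 2)]
    rw [integral_add (integrable_map_cast_binomial _) (integrable_map_cast_binomial _),
      integral_const_mul, integral_const, probReal_univ, one_smul] at e
    have h4 := integral_binomial_sub_mean_pow_four_le (n - 1 + 4) p
    set w := ((n - 1 + 4 : ℕ) : ℝ) * p * (1 - p) with hw
    have hw0 : 0 ≤ w := by positivity
    have hwv : w ≤ 4 * v := by
      have : ((n - 1 + 4 : ℕ) : ℝ) = n + 3 := by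
        push_cast
        linarith
      have h1n : (1 : ℝ) ≤ n := by exact_mod_cast hn
      have hpq : 0 ≤ (p : ℝ) * (1 - p) := by positivity
      rw [hw, hv_def, this]
      nlinarith
    nlinarith
  have hJ0 : 0 ≤ J := integral_nonneg fun x ↦ by positivity
  calc ∫ x : ℝ, (1 / (x + 1) - mu n p) ^ 4 ∂Bin(ℝ, n - 1, p) ≤ 16 * I := h16
    _ ≤ 16 * (24 * J / ((n : ℝ) * p) ^ 4 / (m + 1) ^ 4) := by gcongr
    _ ≤ 16 * (24 * (2464 * v ^ 2) / ((n : ℝ) * p) ^ 4 / ((n : ℝ) * p) ^ 4) := by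
      gcongr
      linarith [p.2.2]
    _ = 946176 * (1 - (p : ℝ)) ^ 2 / ((n : ℝ) * p) ^ 6 := by
      rw [hv_def]
      field_simp
      ring
    _ ≤ 10 ^ 6 * (1 - p) ^ 2 / ((n : ℝ) * p) ^ 6 := by
      gcongr
      norm_num

lemma integral_centered_inv_pow_four_le_sigmaSq (hn : 1 ≤ n) (hp0 : 0 < (p : ℝ))
    (hp1 : (p : ℝ) < 1) (hm : 3 ≤ ((n - 1 : ℕ) : ℝ) * p) (hv : 1 ≤ (n : ℝ) * p * (1 - p)) :
    ∫ x : ℝ, (1 / (x + 1) - mu n p) ^ 4 ∂Bin(ℝ, n - 1, p) ≤ 16 * 10 ^ 6 * sigmaSq n p ^ 2 := by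
  refine (integral_centered_inv_pow_four_le hn hp0 hv).trans ?_
  have hn0 : (0 : ℝ) < n := by exact_mod_cast hn
  have h := pow_le_pow_left₀ (div_nonneg (sub_nonneg.2 p.2.2) (by positivity))
    (le_sigmaSq hn hp1 hm) 2
  calc 10 ^ 6 * (1 - (p : ℝ)) ^ 2 / ((n : ℝ) * p) ^ 6
      = 16 * 10 ^ 6 * ((1 - p) / (4 * ((n : ℝ) * p) ^ 3)) ^ 2 := by
        field_simp
        norm_num
    _ ≤ _ := by gcongr

/-- Used to dominate the degenerate part `D_i D_j` of the kernel by its linear part. -/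
lemma sigmaSq_le_mu_sq (hn : 1 ≤ n) (hp0 : 0 < (p : ℝ)) (hr : 1 ≤ (n : ℝ) * p) :
    sigmaSq n p ≤ 8 * mu n p ^ 2 := by
  refine (sigmaSq_le hn hp0).trans ?_
  have h := pow_le_pow_left₀ (by positivity) (mu_ge hn hr) 2
  calc 2 / ((n : ℝ) * p) ^ 2 = 8 * (1 / (2 * ((n : ℝ) * p))) ^ 2 := by
        field_simp
        norm_num
    _ ≤ _ := by gcongr

lemma mu_nonneg (n : ℕ) (p : unitInterval) : 0 ≤ mu n p :=
  integral_nonneg_of_ae ((ae_binomial_nonneg _ p).mono fun x hx ↦ by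
    simp only [Pi.zero_apply] at hx ⊢
    positivity)

lemma mu_le_one (n : ℕ) (p : unitInterval) : mu n p ≤ 1 := by
  have : mu n p ≤ ∫ _ : ℝ, (1 : ℝ) ∂Bin(ℝ, n - 1, p) := integral_binomial_mono fun x hx ↦ by
    rw [div_le_one (by positivity)]
    linarith
  simpa using this

end InverseMoments

/-! ### Characteristic functions: Lyapunov's theorem and comparison in mean. -/

section CharFun

lemma norm_cexp_mul_I_sub_taylor_le (x : ℝ) :
    ‖Complex.exp (x * Complex.I) - (1 + x * Complex.I - x ^ 2 / 2)‖ ≤ 4 * |x| ^ 3 := by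
  have hx : ‖(x : ℂ) * Complex.I‖ = |x| := by simp
  rcases le_total |x| 1 with h | h
  · have h1 := Complex.exp_bound (x := x * Complex.I) (hx.trans_le h) (n := 3) (by norm_num)
    rw [hx] at h1
    have e : ∑ m ∈ Finset.range 3, ((x : ℂ) * Complex.I) ^ m / (m.factorial : ℂ) =
        1 + x * Complex.I - x ^ 2 / 2 := by
      simp [Finset.sum_range_succ, mul_pow, Nat.factorial]
      ring
    rw [e] at h1
    refine h1.trans ?_
    have : 0 ≤ |x| ^ 3 := by positivity
    norm_num [Nat.factorial]
    linarith
  · have h1 : ‖(x : ℂ) ^ 2 / 2‖ = |x| ^ 2 / 2 := by simp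
    calc ‖Complex.exp (x * Complex.I) - (1 + x * Complex.I - x ^ 2 / 2)‖
        ≤ ‖Complex.exp (x * Complex.I)‖ + (‖(1 : ℂ)‖ + ‖(x : ℂ) * Complex.I‖ + ‖(x : ℂ) ^ 2 / 2‖) :=
          (norm_sub_le _ _).trans (by
            gcongr
            exact (norm_sub_le _ _).trans (by gcongr; exact norm_add_le _ _))
      _ = 1 + (1 + |x| + |x| ^ 2 / 2) := by
          rw [Complex.norm_exp_ofReal_mul_I, hx, h1, norm_one]
      _ ≤ 4 * |x| ^ 3 := by
          have h2 : |x| ≤ |x| ^ 2 := by nlinarith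
          have h3 : |x| ^ 2 ≤ |x| ^ 3 := by nlinarith
          linarith

/-- Trades the third absolute moment for the second and fourth, with a weight `a` left free. -/
lemma abs_pow_three_le (x : ℝ) {a : ℝ} (ha : 0 < a) : |x| ^ 3 ≤ (a * x ^ 2 + x ^ 4 / a) / 2 := by
  have h : a * x ^ 2 + x ^ 4 / a - 2 * |x| ^ 3 = |x| ^ 2 * (a - |x|) ^ 2 / a := by
    have h2 : x ^ 2 = |x| ^ 2 := (sq_abs x).symm
    have h4 : x ^ 4 = |x| ^ 4 := by rw [← abs_pow, abs_of_nonneg (by positivity)]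
    rw [h2, h4]
    field_simp
    ring
  have : 0 ≤ |x| ^ 2 * (a - |x|) ^ 2 / a := by positivity
  linarith

/-- A quantitative second order expansion of the characteristic function of a centered law. -/
lemma norm_charFun_sub_le {ν : Measure ℝ} [IsProbabilityMeasure ν] (h4 : MemLp id 4 ν)
    (hmean : ∫ x, x ∂ν = 0) (u : ℝ) {a : ℝ} (ha : 0 < a) :
    ‖charFun ν u - (1 - ((u ^ 2 * ∫ x, x ^ 2 ∂ν : ℝ) : ℂ) / 2)‖ ≤
      2 * (a * (u ^ 2 * ∫ x, x ^ 2 ∂ν) + (u ^ 4 * ∫ x, x ^ 4 ∂ν) / a) := by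
  have i1 : Integrable (fun x : ℝ ↦ x) ν :=
    (h4.mono_exponent (by norm_num)).integrable (q := 1) le_rfl
  have i2 : Integrable (fun x : ℝ ↦ x ^ 2) ν := by
    simpa using (h4.mono_exponent (p := 2) (by norm_num)).integrable_sq
  have i4 : Integrable (fun x : ℝ ↦ x ^ 4) ν := by
    have := h4.integrable_norm_pow (p := 4) (by norm_num)
    refine this.congr (ae_of_all _ fun x ↦ ?_)
    simp [Even.pow_abs (show Even 4 by decide)]
  have iexp : Integrable (fun x : ℝ ↦ Complex.exp ((u * x : ℝ) * Complex.I)) ν :=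
    Integrable.of_bound (C := 1) (by fun_prop)
      (ae_of_all _ fun x ↦ (Complex.norm_exp_ofReal_mul_I _).le)
  have j1 : Integrable (fun x : ℝ ↦ ((u * x : ℝ) : ℂ) * Complex.I) ν :=
    ((i1.const_mul u).ofReal (𝕜 := ℂ)).mul_const _
  have j2 : Integrable (fun x : ℝ ↦ ((u * x : ℝ) : ℂ) ^ 2 / 2) ν := by
    have := (((i2.const_mul (u ^ 2)).ofReal (𝕜 := ℂ))).div_const 2
    refine this.congr (ae_of_all _ fun x ↦ ?_)
    simp [mul_pow]
  have e : charFun ν u - (1 - ((u ^ 2 * ∫ x, x ^ 2 ∂ν : ℝ) : ℂ) / 2) =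
      ∫ x, (Complex.exp ((u * x : ℝ) * Complex.I) -
        (1 + (u * x : ℝ) * Complex.I - ((u * x : ℝ) : ℂ) ^ 2 / 2)) ∂ν := by
    have j3 : Integrable (fun x : ℝ ↦ 1 + ((u * x : ℝ) : ℂ) * Complex.I) ν :=
      (integrable_const _).add j1
    have j4 : Integrable (fun x : ℝ ↦ 1 + ((u * x : ℝ) : ℂ) * Complex.I -
      ((u * x : ℝ) : ℂ) ^ 2 / 2) ν := j3.sub j2
    rw [integral_sub iexp j4, integral_sub j3 j2, integral_add (integrable_const _) j1,
      charFun_apply_real]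
    have k1 : ∫ x, ((u * x : ℝ) : ℂ) * Complex.I ∂ν = 0 := by
      rw [integral_mul_const, integral_complex_ofReal, integral_const_mul, hmean]
      simp
    have k2 : ∫ x, ((u * x : ℝ) : ℂ) ^ 2 / 2 ∂ν = ((u ^ 2 * ∫ x, x ^ 2 ∂ν : ℝ) : ℂ) / 2 := by
      rw [integral_div, ← integral_const_mul, ← integral_complex_ofReal]
      simp [mul_pow]
    rw [k1, k2]
    simp
  rw [e]
  refine (norm_integral_le_integral_norm _).trans ?_
  rw [← integral_const_mul, ← integral_const_mul, ← integral_const_mul, ← integral_div,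
    ← integral_add ((i2.const_mul _).const_mul _) ((i4.const_mul _).div_const _),
    ← integral_const_mul]
  refine integral_mono_of_nonneg (ae_of_all _ fun x ↦ norm_nonneg _)
    ((((i2.const_mul _).const_mul _).add ((i4.const_mul _).div_const _)).const_mul _)
    (ae_of_all _ fun x ↦ ?_)
  refine (norm_cexp_mul_I_sub_taylor_le (u * x)).trans ?_
  have := abs_pow_three_le (u * x) ha
  simp only [mul_pow] at this ⊢
  linarith

/-- Lyapunov's central limit theorem, on the level of characteristic functions, for a triangular
array with i.i.d. rows. -/
lemma tendsto_charFun_pow_of_pow_four_le {ν : ℕ → Measure ℝ} [∀ n, IsProbabilityMeasure (ν n)]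
    {C : ℝ} (h4 : ∀ n, MemLp id 4 (ν n)) (hmean : ∀ n, ∫ x, x ∂ν n = 0)
    (hpos : ∀ᶠ n in atTop, 0 < ∫ x, x ^ 2 ∂ν n)
    (hC : ∀ᶠ n in atTop, ∫ x, x ^ 4 ∂ν n ≤ C * (∫ x, x ^ 2 ∂ν n) ^ 2) (t : ℝ) :
    Tendsto (fun n : ℕ ↦ charFun (ν n) (t / √(n * ∫ x, x ^ 2 ∂ν n)) ^ (n + 1)) atTop
      (𝓝 (Complex.exp (-t ^ 2 / 2))) := by
  set φ : ℕ → ℂ := fun n ↦ charFun (ν n) (t / √(n * ∫ x, x ^ 2 ∂ν n)) with hφ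
  have hbound : ∀ᶠ n : ℕ in atTop, ‖φ n - (1 + (-(t : ℂ) ^ 2 / 2) / n)‖ ≤
      (2 * (t ^ 2 + C * t ^ 4)) * (1 / √n) * ‖1 / (n : ℂ)‖ := by
    filter_upwards [hpos, hC, eventually_gt_atTop 0] with n hs hCn hn
    have hn0 : (0 : ℝ) < n := by exact_mod_cast hn
    set s := ∫ x, x ^ 2 ∂ν n with hs_def
    set u := t / √(n * s) with hu
    have hu2 : u ^ 2 * s = t ^ 2 / n := by
      rw [hu, div_pow, Real.sq_sqrt (by positivity)]
      field_simp
    have hu4 : u ^ 4 * s ^ 2 = t ^ 4 / n ^ 2 := by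
      rw [show u ^ 4 * s ^ 2 = (u ^ 2 * s) ^ 2 by ring, hu2, div_pow]
      ring
    -- This weight balances the two error terms, of sizes `a/n` and `1/(a n²)`: both become
    -- `n^(-3/2)`.
    have h := norm_charFun_sub_le (h4 n) (hmean n) u (a := 1 / √n) (by positivity)
    rw [← hs_def, hu2] at h
    have e : (1 : ℂ) + (-(t : ℂ) ^ 2 / 2) / n = 1 - ((t ^ 2 / n : ℝ) : ℂ) / 2 := by
      push_cast
      ring
    rw [e]
    refine h.trans ?_
    have h5 : u ^ 4 * ∫ x, x ^ 4 ∂ν n ≤ C * (t ^ 4 / n ^ 2) := by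
      rw [← hu4]
      calc u ^ 4 * ∫ x, x ^ 4 ∂ν n ≤ u ^ 4 * (C * s ^ 2) := by gcongr
        _ = _ := by ring
    have hnorm : ‖1 / (n : ℂ)‖ = 1 / n := by simp
    have hsq : √(n : ℝ) * √n = n := Real.mul_self_sqrt hn0.le
    rw [hnorm]
    calc 2 * (1 / √n * (t ^ 2 / n) + (u ^ 4 * ∫ x, x ^ 4 ∂ν n) / (1 / √n))
        ≤ 2 * (1 / √n * (t ^ 2 / n) + (C * (t ^ 4 / n ^ 2)) / (1 / √n)) := by gcongr
      _ = 2 * (1 / √n * (t ^ 2 / n) + C * t ^ 4 * (√n / n) * (1 / n)) := by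
        field_simp
      _ = 2 * (t ^ 2 + C * t ^ 4) * (1 / √n) * (1 / n) := by
        have : √(n : ℝ) / n = 1 / √n := Real.sqrt_div_self'
        rw [this]
        ring
  have hsqrt : Tendsto (fun n : ℕ ↦ (2 * (t ^ 2 + C * t ^ 4)) * (1 / √(n : ℝ))) atTop (𝓝 0) := by
    have h : Tendsto (fun n : ℕ ↦ 1 / √(n : ℝ)) atTop (𝓝 0) := by
      simp only [one_div]
      exact tendsto_inv_atTop_zero.comp (Real.tendsto_sqrt_atTop.comp tendsto_natCast_atTop_atTop)
    simpa only [mul_zero] using h.const_mul (2 * (t ^ 2 + C * t ^ 4))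
  have hlo : (fun n : ℕ ↦ φ n - (1 + (-(t : ℂ) ^ 2 / 2) / n)) =o[atTop] fun n ↦ 1 / (n : ℂ) := by
    rw [Asymptotics.isLittleO_iff]
    intro c hc
    filter_upwards [hbound, hsqrt.eventually_le_const hc] with n h1 h2
    exact h1.trans (by gcongr)
  have hpow := Complex.tendsto_pow_exp_of_isLittleO_sub_add_div _ hlo
  -- There are `n + 1` summands but the scale is `n`; the extra factor tends to 1.
  have hone : Tendsto φ atTop (𝓝 1) := by
    have h1 : Tendsto (fun n : ℕ ↦ φ n - (1 + (-(t : ℂ) ^ 2 / 2) / n)) atTop (𝓝 0) := by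
      refine hlo.trans_tendsto ?_
      simpa using tendsto_one_div_atTop_nhds_zero_nat (𝕜 := ℂ)
    have h2 : Tendsto (fun n : ℕ ↦ (1 + (-(t : ℂ) ^ 2 / 2) / n)) atTop (𝓝 (1 + 0)) :=
      tendsto_const_nhds.add (tendsto_const_div_atTop_nhds_zero_nat _)
    simpa using h1.add h2
  have h := hpow.mul hone
  rw [mul_one] at h
  exact h.congr fun n ↦ (pow_succ _ _).symm

/-- `x ↦ exp(itx)` is `|t|`-Lipschitz. This plays the role of Slutsky's theorem. -/
lemma norm_charFun_map_sub_le {Ω : Type*} [MeasurableSpace Ω] {P : Measure Ω}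
    [IsProbabilityMeasure P] {A B : Ω → ℝ} (hA : AEMeasurable A P) (hB : AEMeasurable B P)
    (hint : Integrable (fun ω ↦ A ω - B ω) P) (t : ℝ) :
    ‖charFun (P.map A) t - charFun (P.map B) t‖ ≤ |t| * ∫ ω, |A ω - B ω| ∂P := by
  have hexp : ∀ {X : Ω → ℝ}, AEMeasurable X P →
      Integrable (fun ω ↦ Complex.exp (t * X ω * Complex.I)) P := fun {X} hX ↦
    Integrable.of_bound (C := 1) (AEMeasurable.aestronglyMeasurable (by fun_prop))
      (ae_of_all _ fun ω ↦ by
        rw [← Complex.ofReal_mul, Complex.norm_exp_ofReal_mul_I])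
  rw [charFun_apply_real, charFun_apply_real, integral_map hA (by fun_prop),
    integral_map hB (by fun_prop), ← integral_sub (hexp hA) (hexp hB), ← integral_const_mul]
  refine (norm_integral_le_integral_norm _).trans ?_
  refine integral_mono_of_nonneg (ae_of_all _ fun ω ↦ norm_nonneg _) (hint.abs.const_mul _)
    (ae_of_all _ fun ω ↦ ?_)
  have e : Complex.exp (t * A ω * Complex.I) - Complex.exp (t * B ω * Complex.I) =
      Complex.exp ((t * B ω : ℝ) * Complex.I) *
        (Complex.exp (Complex.I * (t * (A ω - B ω) : ℝ)) - 1) := by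
    rw [mul_sub, ← Complex.exp_add, mul_one]
    push_cast
    congr 2
    ring
  dsimp only
  rw [e, norm_mul, Complex.norm_exp_ofReal_mul_I, one_mul, ← abs_mul]
  exact Real.norm_exp_I_mul_ofReal_sub_one_le

end CharFun

/-! ### Factorization and orthogonality. -/

section Independence

variable {Ω : Type*} [MeasurableSpace Ω] {P : Measure Ω}

/-- Splits off a variable that occurs in no other factor; if its factor is centered, the integral
vanishes. -/
lemma integral_mul_of_iIndepFun {ι : Type*} {ξ : ι → Ω → ℝ} (h : iIndepFun ξ P)
    (hm : ∀ i, Measurable (ξ i)) {v : ι} {T : Finset ι} (hv : v ∉ T) {φ : ℝ → ℝ}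
    (hφ : Measurable φ) {ψ : (T → ℝ) → ℝ} (hψ : Measurable ψ) :
    ∫ ω, φ (ξ v ω) * ψ (fun i ↦ ξ i ω) ∂P =
      (∫ ω, φ (ξ v ω) ∂P) * ∫ ω, ψ (fun i ↦ ξ i ω) ∂P := by
  have h1 := h.indepFun_finset {v} T (by simpa using hv) hm
  have h2 := h1.comp (φ := fun x : ({v} : Finset ι) → ℝ ↦ φ (x ⟨v, by simp⟩)) (ψ := ψ)
    (hφ.comp (measurable_pi_apply _)) hψ
  have hψm : Measurable fun ω ↦ ψ (fun i : T ↦ ξ i ω) := by fun_prop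
  exact h2.integral_fun_mul_eq_mul_integral (hφ.comp (hm v)).aestronglyMeasurable
    hψm.aestronglyMeasurable

lemma integral_sum_sq_of_orthogonal {α : Type*} (Q : Finset α) (T : α → Ω → ℝ)
    (hint : ∀ a ∈ Q, ∀ b ∈ Q, Integrable (fun ω ↦ T a ω * T b ω) P)
    (horth : ∀ a ∈ Q, ∀ b ∈ Q, a ≠ b → ∫ ω, T a ω * T b ω ∂P = 0) :
    ∫ ω, (∑ a ∈ Q, T a ω) ^ 2 ∂P = ∑ a ∈ Q, ∫ ω, T a ω ^ 2 ∂P := by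
  simp_rw [sq, Finset.sum_mul_sum]
  rw [integral_finsetSum _ fun a ha ↦ integrable_finsetSum _ fun b hb ↦ hint a ha b hb]
  refine Finset.sum_congr rfl fun a ha ↦ ?_
  rw [integral_finsetSum _ fun b hb ↦ hint a ha b hb, Finset.sum_eq_single a]
  · exact fun b hb hba ↦ horth a ha b hb hba.symm
  · exact fun h ↦ (h ha).elim

lemma memLp_top_mul {f g : Ω → ℝ} (hf : MemLp f ⊤ P) (hg : MemLp g ⊤ P) :
    MemLp (fun ω ↦ f ω * g ω) ⊤ P :=
  hg.mul' hf

lemma memLp_top_pow {f : Ω → ℝ} [IsProbabilityMeasure P] (hf : MemLp f ⊤ P) (k : ℕ) :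
    MemLp (fun ω ↦ f ω ^ k) ⊤ P := by
  induction k with
  | zero => simpa using memLp_const 1
  | succ k ih =>
    simp_rw [pow_succ]
    exact memLp_top_mul ih hf

end Independence

/-- Bounded centered vertex variables `D` of variance `s` and `{0, 1}`-valued edge variables `Z` of
mean `p`, all independent. -/
structure IsCenteredArray {Ω V : Type*} [MeasurableSpace Ω] (P : Measure Ω)
    (D : V → Ω → ℝ) (Z : Sym2 V → Ω → ℝ) (s p : ℝ) : Prop where
  indep : iIndepFun (Sum.elim D (fun e : {e : Sym2 V // ¬ e.IsDiag} ↦ Z e)) P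
  measurable_vertex : ∀ i, Measurable (D i)
  measurable_edge : ∀ e, Measurable (Z e)
  memLp_vertex : ∀ i, MemLp (D i) ⊤ P
  integral_vertex : ∀ i, ∫ ω, D i ω ∂P = 0
  integral_vertex_sq : ∀ i, ∫ ω, D i ω ^ 2 ∂P = s
  edge_eq : ∀ e : Sym2 V, ¬ e.IsDiag → ∀ᵐ ω ∂P, Z e ω = 0 ∨ Z e ω = 1
  integral_edge : ∀ e : Sym2 V, ¬ e.IsDiag → ∫ ω, Z e ω ∂P = p

/-! ### Second moments for centered vertex and edge arrays. -/

namespace IsCenteredArray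

variable {Ω V : Type*} [MeasurableSpace Ω] {P : Measure Ω}
  {D : V → Ω → ℝ} {Z : Sym2 V → Ω → ℝ} {s p : ℝ}

lemma memLp_edge (h : IsCenteredArray P D Z s p)
    {e : Sym2 V} (he : ¬ e.IsDiag) : MemLp (Z e) ⊤ P := by
  refine memLp_top_of_bound (h.measurable_edge e).aestronglyMeasurable 1 ?_
  filter_upwards [h.edge_eq e he] with ω hω
  rcases hω with hω | hω <;> simp [hω]

lemma measurable_elim (h : IsCenteredArray P D Z s p) (a : V ⊕ {e : Sym2 V // ¬ e.IsDiag}) :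
    Measurable (Sum.elim D (fun e : {e : Sym2 V // ¬ e.IsDiag} ↦ Z e) a) := by
  cases a with
  | inl i => exact h.measurable_vertex i
  | inr e => exact h.measurable_edge e

lemma integral_edge_sq (h : IsCenteredArray P D Z s p)
    {e : Sym2 V} (he : ¬ e.IsDiag) : ∫ ω, Z e ω ^ 2 ∂P = p := by
  rw [← h.integral_edge e he]
  refine integral_congr_ae ?_
  filter_upwards [h.edge_eq e he] with ω hω
  rcases hω with hω | hω <;> simp [hω]

lemma integral_edge_sub [IsProbabilityMeasure P] (h : IsCenteredArray P D Z s p)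
    {e : Sym2 V} (he : ¬ e.IsDiag) : ∫ ω, (Z e ω - p) ∂P = 0 := by
  rw [integral_sub ((h.memLp_edge he).integrable le_top) (integrable_const _),
    h.integral_edge e he]
  simp

lemma integral_edge_sub_sq_le [IsProbabilityMeasure P] (h : IsCenteredArray P D Z s p)
    {e : Sym2 V} (he : ¬ e.IsDiag) : ∫ ω, (Z e ω - p) ^ 2 ∂P ≤ p := by
  have h2 : Integrable (fun ω ↦ Z e ω ^ 2) P :=
    (memLp_top_pow (h.memLp_edge he) 2).integrable le_top
  have h1 : Integrable (fun ω ↦ 2 * p * Z e ω) P :=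
    ((h.memLp_edge he).integrable le_top).const_mul _
  have e1 : ∀ ω, (Z e ω - p) ^ 2 = Z e ω ^ 2 - (2 * p * Z e ω - p ^ 2) := fun ω ↦ by ring
  have h3 : Integrable (fun ω ↦ 2 * p * Z e ω - p ^ 2) P := h1.sub (integrable_const _)
  simp_rw [e1]
  rw [integral_sub h2 h3, integral_sub h1 (integrable_const _), h.integral_edge_sq he,
    integral_const_mul, h.integral_edge e he]
  simp only [integral_const, probReal_univ, smul_eq_mul, one_mul]
  nlinarith [sq_nonneg p]

lemma integral_vertex_mul (h : IsCenteredArray P D Z s p)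
    {i j : V} (hij : i ≠ j) : ∫ ω, D i ω * D j ω ∂P = 0 := by
  have := (h.indep.indepFun (i := Sum.inl i) (j := Sum.inl j)
    (by simpa using hij)).integral_fun_mul_eq_mul_integral
    (h.measurable_vertex i).aestronglyMeasurable (h.measurable_vertex j).aestronglyMeasurable
  simpa [h.integral_vertex] using this

lemma integral_vertex_sq_mul_sq (h : IsCenteredArray P D Z s p) {i j : V} (hij : i ≠ j) :
    ∫ ω, D i ω ^ 2 * D j ω ^ 2 ∂P = s ^ 2 := by
  have := ((h.indep.indepFun (i := Sum.inl i) (j := Sum.inl j)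
    (by simpa using hij)).comp (φ := fun x ↦ x ^ 2) (ψ := fun x ↦ x ^ 2) (by fun_prop)
      (by fun_prop)).integral_fun_mul_eq_mul_integral
    ((h.measurable_vertex i).pow_const 2).aestronglyMeasurable
    ((h.measurable_vertex j).pow_const 2).aestronglyMeasurable
  simpa [h.integral_vertex_sq, ← sq] using this

lemma integral_vertex_add_sq [IsProbabilityMeasure P] (h : IsCenteredArray P D Z s p)
    {i j : V} (hij : i ≠ j) :
    ∫ ω, (D i ω + D j ω) ^ 2 ∂P = 2 * s := by
  have e : ∀ ω, (D i ω + D j ω) ^ 2 = D i ω ^ 2 + (2 * (D i ω * D j ω) + D j ω ^ 2) :=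
    fun ω ↦ by ring
  have h2 : ∀ i, Integrable (fun ω ↦ D i ω ^ 2) P := fun i ↦
    (memLp_top_pow (h.memLp_vertex i) 2).integrable le_top
  have h1 : Integrable (fun ω ↦ 2 * (D i ω * D j ω)) P :=
    ((memLp_top_mul (h.memLp_vertex i) (h.memLp_vertex j)).integrable le_top).const_mul 2
  have h3 : Integrable (fun ω ↦ 2 * (D i ω * D j ω) + D j ω ^ 2) P := h1.add (h2 j)
  simp_rw [e]
  rw [integral_add (h2 i) h3, integral_add h1 (h2 j), integral_const_mul,
    h.integral_vertex_mul hij, h.integral_vertex_sq, h.integral_vertex_sq]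
  ring

lemma integral_edge_mul_vertices [IsProbabilityMeasure P] (h : IsCenteredArray P D Z s p)
    {e : Sym2 V} (he : ¬ e.IsDiag) (i j : V) {φ : ℝ → ℝ}
    (hφ : Measurable φ) {ψ : ℝ × ℝ → ℝ} (hψ : Measurable ψ) :
    ∫ ω, φ (Z e ω) * ψ (D i ω, D j ω) ∂P = (∫ ω, φ (Z e ω) ∂P) * ∫ ω, ψ (D i ω, D j ω) ∂P := by
  classical
  exact integral_mul_of_iIndepFun h.indep h.measurable_elim (v := Sum.inr ⟨e, he⟩)
    (T := {Sum.inl i, Sum.inl j}) (by simp) hφ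
    (ψ := fun x ↦ ψ (x ⟨Sum.inl i, by simp⟩, x ⟨Sum.inl j, by simp⟩)) (by fun_prop)

lemma integral_centeredEdge_orthogonal [IsProbabilityMeasure P] (h : IsCenteredArray P D Z s p)
    {e f : Sym2 V} (he : ¬ e.IsDiag) (hf : ¬ f.IsDiag)
    (hef : e ≠ f) (i j k l : V) :
    ∫ ω, ((D i ω + D j ω) * (Z e ω - p)) * ((D k ω + D l ω) * (Z f ω - p)) ∂P = 0 := by
  classical
  have := integral_mul_of_iIndepFun h.indep h.measurable_elim (v := Sum.inr ⟨e, he⟩)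
    (T := {Sum.inl i, Sum.inl j, Sum.inl k, Sum.inl l, Sum.inr ⟨f, hf⟩}) (by simpa using hef)
    (φ := fun x ↦ x - p) (by fun_prop)
    (ψ := fun x ↦ (x ⟨Sum.inl i, by simp⟩ + x ⟨Sum.inl j, by simp⟩) *
      ((x ⟨Sum.inl k, by simp⟩ + x ⟨Sum.inl l, by simp⟩) * (x ⟨Sum.inr ⟨f, hf⟩, by simp⟩ - p)))
    (by fun_prop)
  simp only [Sum.elim_inl, Sum.elim_inr, h.integral_edge_sub he, zero_mul] at this
  rw [← this]
  congr 1 with ω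
  ring

lemma integral_degenerate_orthogonal_of_ne [IsProbabilityMeasure P] (h : IsCenteredArray P D Z s p)
    {e f : Sym2 V} (he : ¬ e.IsDiag) (hf : ¬ f.IsDiag)
    {i j k l : V} (hij : i ≠ j) (hik : i ≠ k) (hil : i ≠ l) :
    ∫ ω, (Z e ω * (D i ω * D j ω)) * (Z f ω * (D k ω * D l ω)) ∂P = 0 := by
  classical
  have := integral_mul_of_iIndepFun h.indep h.measurable_elim (v := Sum.inl i)
    (T := {Sum.inl j, Sum.inl k, Sum.inl l, Sum.inr ⟨e, he⟩, Sum.inr ⟨f, hf⟩})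
    (by simp [hij, hik, hil]) (φ := fun x ↦ x) (by fun_prop)
    (ψ := fun x ↦ (x ⟨Sum.inr ⟨e, he⟩, by simp⟩ * x ⟨Sum.inl j, by simp⟩) *
      (x ⟨Sum.inr ⟨f, hf⟩, by simp⟩ * (x ⟨Sum.inl k, by simp⟩ * x ⟨Sum.inl l, by simp⟩)))
    (by fun_prop)
  simp only [Sum.elim_inl, Sum.elim_inr, h.integral_vertex, zero_mul] at this
  rw [← this]
  congr 1 with ω
  ring

/-- Of two distinct edges, the first has an endpoint outside the second, and the centered variable
there occurs only once. -/
lemma integral_degenerate_orthogonal [IsProbabilityMeasure P] (h : IsCenteredArray P D Z s p)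
    {i j k l : V} (hij : i ≠ j) (hkl : k ≠ l)
    (hne : s(i, j) ≠ s(k, l)) :
    ∫ ω, (Z s(i, j) ω * (D i ω * D j ω)) * (Z s(k, l) ω * (D k ω * D l ω)) ∂P = 0 := by
  have he : ¬ s(i, j).IsDiag := by simpa using hij
  have hf : ¬ s(k, l).IsDiag := by simpa using hkl
  by_cases hi : i ≠ k ∧ i ≠ l
  · exact h.integral_degenerate_orthogonal_of_ne he hf hij hi.1 hi.2
  · have hj : j ≠ k ∧ j ≠ l := by
      rw [Ne, Sym2.eq_iff] at hne
      grind
    rw [← h.integral_degenerate_orthogonal_of_ne he hf hij.symm hj.1 hj.2]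
    congr 1 with ω
    ring

lemma integral_kernel_sq_le [IsProbabilityMeasure P] (h : IsCenteredArray P D Z s p)
    {i j : V} (hij : i ≠ j) (μ : ℝ) :
    ∫ ω, (Z s(i, j) ω * (μ * (D i ω + D j ω) + D i ω * D j ω)) ^ 2 ∂P ≤
      p * (4 * μ ^ 2 * s + 2 * s ^ 2) := by
  have he : ¬ s(i, j).IsDiag := by simpa using hij
  have e1 := h.integral_edge_mul_vertices he i j (φ := fun x ↦ x ^ 2) (by fun_prop)
    (ψ := fun x ↦ (μ * (x.1 + x.2) + x.1 * x.2) ^ 2) (by fun_prop)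
  simp_rw [mul_pow]
  simp only [h.integral_edge_sq he] at e1
  rw [e1]
  have hp : 0 ≤ p := by
    rw [← h.integral_edge_sq he]
    exact integral_nonneg fun ω ↦ sq_nonneg _
  refine mul_le_mul_of_nonneg_left ?_ hp
  have i1 : Integrable (fun ω ↦ (D i ω + D j ω) ^ 2) P :=
    (memLp_top_pow ((h.memLp_vertex i).add (h.memLp_vertex j)) 2).integrable le_top
  have i2 : Integrable (fun ω ↦ D i ω ^ 2 * D j ω ^ 2) P :=
    (memLp_top_mul (memLp_top_pow (h.memLp_vertex i) 2)
      (memLp_top_pow (h.memLp_vertex j) 2)).integrable le_top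
  calc ∫ ω, (μ * (D i ω + D j ω) + D i ω * D j ω) ^ 2 ∂P
      ≤ ∫ ω, (2 * μ ^ 2 * (D i ω + D j ω) ^ 2 + 2 * (D i ω ^ 2 * D j ω ^ 2)) ∂P := by
        refine integral_mono_of_nonneg (ae_of_all _ fun ω ↦ sq_nonneg _)
          ((i1.const_mul _).add (i2.const_mul _)) (ae_of_all _ fun ω ↦ ?_)
        dsimp only
        nlinarith [sq_nonneg (μ * (D i ω + D j ω) - D i ω * D j ω)]
    _ = _ := by
        rw [integral_add (i1.const_mul _) (i2.const_mul _), integral_const_mul,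
          integral_const_mul, h.integral_vertex_add_sq hij, h.integral_vertex_sq_mul_sq hij]
        ring

section Remainder

variable [LinearOrder V]

/-- The part of the statistic carried by the centered edge variables and the degenerate part of the
kernel has a small second moment. -/
lemma integral_remainder_sq_le [IsProbabilityMeasure P] (h : IsCenteredArray P D Z s p)
    (Q : Finset (V × V)) (hQ : ∀ a ∈ Q, a.1 < a.2) (μ : ℝ) :
    ∫ ω, (∑ a ∈ Q, (μ * ((D a.1 ω + D a.2 ω) * (Z s(a.1, a.2) ω - p)) +
      Z s(a.1, a.2) ω * (D a.1 ω * D a.2 ω))) ^ 2 ∂P ≤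
      Q.card * (p * (4 * μ ^ 2 * s + 2 * s ^ 2)) := by
  have hdiag : ∀ a ∈ Q, ¬ s(a.1, a.2).IsDiag := fun a ha ↦ by simpa using (hQ a ha).ne
  -- Ordered pairs in `Q` are increasing, so the underlying unordered pair determines them.
  have hne : ∀ a ∈ Q, ∀ b ∈ Q, a ≠ b → s(a.1, a.2) ≠ s(b.1, b.2) := by
    intro a ha b hb hab hs
    have h1 := hQ a ha
    have h2 := hQ b hb
    rw [Sym2.eq_iff] at hs
    rcases hs with hs | hs
    · exact hab (Prod.ext hs.1 hs.2)
    · rw [hs.1, hs.2] at h1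
      exact lt_asymm h1 h2
  set A : V × V → Ω → ℝ := fun a ω ↦ (D a.1 ω + D a.2 ω) * (Z s(a.1, a.2) ω - p) with hA
  set B : V × V → Ω → ℝ := fun a ω ↦ Z s(a.1, a.2) ω * (D a.1 ω * D a.2 ω) with hB
  have mA : ∀ a ∈ Q, MemLp (A a) ⊤ P := fun a ha ↦
    memLp_top_mul ((h.memLp_vertex _).add (h.memLp_vertex _))
      ((h.memLp_edge (hdiag a ha)).sub (memLp_const p))
  have mB : ∀ a ∈ Q, MemLp (B a) ⊤ P := fun a ha ↦
    memLp_top_mul (h.memLp_edge (hdiag a ha))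
      (memLp_top_mul (h.memLp_vertex _) (h.memLp_vertex _))
  have sA : ∫ ω, (∑ a ∈ Q, A a ω) ^ 2 ∂P ≤ Q.card * (2 * s * p) := by
    rw [integral_sum_sq_of_orthogonal Q A
      (fun a ha b hb ↦ (memLp_top_mul (mA a ha) (mA b hb)).integrable le_top)
      (fun a ha b hb hab ↦ h.integral_centeredEdge_orthogonal (hdiag a ha) (hdiag b hb)
        (hne a ha b hb hab) _ _ _ _), ← nsmul_eq_mul]
    refine Finset.sum_le_card_nsmul _ _ _ fun a ha ↦ ?_
    have e1 := h.integral_edge_mul_vertices (hdiag a ha) a.1 a.2 (φ := fun x ↦ (x - p) ^ 2)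
      (by fun_prop) (ψ := fun x ↦ (x.1 + x.2) ^ 2) (by fun_prop)
    simp only [h.integral_vertex_add_sq (hQ a ha).ne] at e1
    have hs : 0 ≤ s := by
      rw [← h.integral_vertex_sq a.1]
      exact integral_nonneg fun ω ↦ sq_nonneg _
    calc ∫ ω, A a ω ^ 2 ∂P = ∫ ω, (Z s(a.1, a.2) ω - p) ^ 2 * (D a.1 ω + D a.2 ω) ^ 2 ∂P := by
          congr 1 with ω
          rw [hA]
          ring
      _ ≤ _ := by
          rw [e1, mul_comm]
          exact mul_le_mul_of_nonneg_left (h.integral_edge_sub_sq_le (hdiag a ha)) (by positivity)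
  have sB : ∫ ω, (∑ a ∈ Q, B a ω) ^ 2 ∂P = Q.card * (p * s ^ 2) := by
    rw [integral_sum_sq_of_orthogonal Q B
      (fun a ha b hb ↦ (memLp_top_mul (mB a ha) (mB b hb)).integrable le_top)
      (fun a ha b hb hab ↦ h.integral_degenerate_orthogonal (hQ a ha).ne (hQ b hb).ne
        (hne a ha b hb hab)), ← nsmul_eq_mul]
    refine Finset.sum_eq_card_nsmul fun a ha ↦ ?_
    have e1 := h.integral_edge_mul_vertices (hdiag a ha) a.1 a.2 (φ := fun x ↦ x ^ 2)
      (by fun_prop) (ψ := fun x ↦ x.1 ^ 2 * x.2 ^ 2) (by fun_prop)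
    simp only [h.integral_vertex_sq_mul_sq (hQ a ha).ne, h.integral_edge_sq (hdiag a ha)] at e1
    rw [← e1]
    congr 1 with ω
    rw [hB]
    ring
  have iA : Integrable (fun ω ↦ (∑ a ∈ Q, A a ω) ^ 2) P :=
    (memLp_top_pow (memLp_finsetSum Q mA) 2).integrable le_top
  have iB : Integrable (fun ω ↦ (∑ a ∈ Q, B a ω) ^ 2) P :=
    (memLp_top_pow (memLp_finsetSum Q mB) 2).integrable le_top
  calc ∫ ω, (∑ a ∈ Q, (μ * A a ω + B a ω)) ^ 2 ∂P
      ≤ ∫ ω, (2 * μ ^ 2 * (∑ a ∈ Q, A a ω) ^ 2 + 2 * (∑ a ∈ Q, B a ω) ^ 2) ∂P := by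
        refine integral_mono_of_nonneg (ae_of_all _ fun ω ↦ sq_nonneg _)
          ((iA.const_mul _).add (iB.const_mul _)) (ae_of_all _ fun ω ↦ ?_)
        dsimp only
        rw [Finset.sum_add_distrib, ← Finset.mul_sum]
        nlinarith [sq_nonneg (μ * ∑ a ∈ Q, A a ω - ∑ a ∈ Q, B a ω)]
    _ = 2 * μ ^ 2 * ∫ ω, (∑ a ∈ Q, A a ω) ^ 2 ∂P + 2 * (Q.card * (p * s ^ 2)) := by
        rw [integral_add (iA.const_mul _) (iB.const_mul _), integral_const_mul,
          integral_const_mul, sB]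
    _ ≤ 2 * μ ^ 2 * (Q.card * (2 * s * p)) + 2 * (Q.card * (p * s ^ 2)) := by gcongr
    _ = _ := by ring

end Remainder

end IsCenteredArray

/-! ### Decomposition and normalization of the statistic. -/

section Statistic

lemma condExp_add_mul_of_indep {Ω : Type*} {m m₁ m₀ : MeasurableSpace Ω} {P : Measure Ω}
    [IsProbabilityMeasure P] (hm : m ≤ m₀) (hm₁ : m₁ ≤ m₀) (hind : Indep m₁ m P) {f g d : Ω → ℝ}
    (hf : Measurable[m] f) (hg : Measurable[m] g) (hd : Measurable[m₁] d) (hfi : Integrable f P)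
    (hgi : Integrable (g * d) P) (hdi : Integrable d P) (hd0 : ∫ ω, d ω ∂P = 0) :
    P[f + g * d | m] =ᵐ[P] f := by
  have c2 := condExp_of_stronglyMeasurable hm hf.stronglyMeasurable hfi
  filter_upwards [condExp_add hfi hgi m,
    condExp_mul_of_stronglyMeasurable_left hg.stronglyMeasurable hgi hdi,
    condExp_indep_eq hm₁ hm hd.stronglyMeasurable hind] with ω h1 h3 h4
  rw [h1, Pi.add_apply, c2, h3, Pi.mul_apply, h4, hd0, mul_zero, add_zero]

/-- Pointwise AM–GM in place of Cauchy–Schwarz; the weight `a` is chosen near the L² norm. -/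
lemma integral_abs_le_of_sq {Ω : Type*} [MeasurableSpace Ω] {P : Measure Ω}
    [IsProbabilityMeasure P] {f : Ω → ℝ} (hf : Integrable f P)
    (hf2 : Integrable (fun ω ↦ f ω ^ 2) P) {a : ℝ} (ha : 0 < a) :
    ∫ ω, |f ω| ∂P ≤ (a + (∫ ω, f ω ^ 2 ∂P) / a) / 2 := by
  have e : ∫ ω, |f ω| ∂P ≤ ∫ ω, (a + f ω ^ 2 / a) / 2 ∂P := by
    refine integral_mono hf.abs (((integrable_const _).add (hf2.div_const _)).div_const 2)
      fun ω ↦ ?_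
    have h1 : a + f ω ^ 2 / a - 2 * |f ω| = (a - |f ω|) ^ 2 / a := by
      rw [← sq_abs (f ω)]
      field_simp
      ring
    have h2 : 0 ≤ (a - |f ω|) ^ 2 / a := by positivity
    dsimp only
    linarith
  rw [integral_div, integral_add (integrable_const _) (hf2.div_const _), integral_div] at e
  simpa using e

/-- Factor `θ² - κ² = (θ - κ)(θ + κ) = b/2`. -/
lemma abs_div_sub_one_le {κ θ b r : ℝ} (hκ : 0 < κ) (hκθ : κ ≤ θ) (hr : 0 < r)
    (hθ : θ ^ 2 = κ ^ 2 + b / 2) (hb : b ≤ 20 * (κ ^ 2 / r)) : |κ / θ - 1| ≤ 10 / r := by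
  have hθ0 : 0 < θ := hκ.trans_le hκθ
  have h1 : κ / θ ≤ 1 := (div_le_one hθ0).2 hκθ
  rw [abs_of_nonpos (by linarith), neg_sub, one_sub_div hθ0.ne', div_le_div_iff₀ hθ0 hr]
  have h3 : b * r ≤ 20 * κ ^ 2 := by
    have := mul_le_mul_of_nonneg_right hb hr.le
    rwa [mul_assoc, div_mul_cancel₀ _ hr.ne'] at this
  have h2 : (θ - κ) * (θ + κ) * r ≤ 10 * κ ^ 2 := by
    have : (θ - κ) * (θ + κ) * r = b * r / 2 := by linear_combination r * hθ
    linarith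
  have h4 : (θ - κ) * r * κ ≤ 10 * θ * κ := by
    have : 0 ≤ (θ - κ) * r := mul_nonneg (by linarith) hr.le
    nlinarith
  exact le_of_mul_le_mul_right h4 hκ

lemma abs_centered_inv_le_one {n : ℕ} {p : unitInterval} {x : ℝ} (hx : 0 ≤ x) :
    |1 / (x + 1) - mu n p| ≤ 1 := by
  have h1 : 1 / (x + 1) ≤ 1 := by
    rw [div_le_one (by positivity)]
    linarith
  have h2 : 0 ≤ 1 / (x + 1) := by positivity
  rw [abs_le]
  constructor <;> linarith [mu_nonneg n p, mu_le_one n p]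

lemma kernel_eq (n : ℕ) (p : unitInterval) (x y : ℝ) :
    kernel n p x y = mu n p * ((1 / (x + 1) - mu n p) + (1 / (y + 1) - mu n p)) +
      (1 / (x + 1) - mu n p) * (1 / (y + 1) - mu n p) := by
  have h : 1 / ((x + 1) * (y + 1)) = 1 / (x + 1) * (1 / (y + 1)) := by
    simp only [one_div, mul_inv]
  rw [kernel, h]
  ring

/-- Each vertex lies in exactly `n` pairs. -/
lemma sum_pairs_add {n : ℕ} (D : Fin (n + 1) → ℝ) :
    ∑ a : Fin (n + 1) × Fin (n + 1) with a.1 < a.2, (D a.1 + D a.2) = n * ∑ i, D i := by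
  rw [Finset.sum_add_distrib,
    Finset.sum_finset_product (r := {a : Fin (n + 1) × Fin (n + 1) | a.1 < a.2})
      (s := Finset.univ) (t := fun i ↦ Finset.Ioi i) (by simp) (f := fun a ↦ D a.1),
    Finset.sum_finset_product_right (r := {a : Fin (n + 1) × Fin (n + 1) | a.1 < a.2})
      (s := Finset.univ) (t := fun i ↦ Finset.Iio i) (by simp) (f := fun a ↦ D a.2),
    ← Finset.sum_add_distrib, Finset.mul_sum]
  refine Finset.sum_congr rfl fun i _ ↦ ?_
  dsimp only
  rw [Finset.sum_const, Finset.sum_const, Fin.card_Ioi, Fin.card_Iio, nsmul_eq_mul, nsmul_eq_mul,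
    ← add_mul, ← Nat.cast_add]
  congr 2
  omega

lemma V_eq {Ω : Type*} {n : ℕ} {p : unitInterval} (X : Fin (n + 1) → Ω → ℝ)
    (Z : Sym2 (Fin (n + 1)) → Ω → ℝ) (ω : Ω) :
    V n p X Z ω = n * p * mu n p * ∑ i, (1 / (X i ω + 1) - mu n p) +
      ∑ a : Fin (n + 1) × Fin (n + 1) with a.1 < a.2,
        (mu n p * (((1 / (X a.1 ω + 1) - mu n p) + (1 / (X a.2 ω + 1) - mu n p)) *
          (Z s(a.1, a.2) ω - p)) + Z s(a.1, a.2) ω *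
          ((1 / (X a.1 ω + 1) - mu n p) * (1 / (X a.2 ω + 1) - mu n p))) := by
  have h := sum_pairs_add fun i ↦ 1 / (X i ω + 1) - mu n p
  rw [V, ← Finset.sum_finset_product (r := {a : Fin (n + 1) × Fin (n + 1) | a.1 < a.2})
    (s := Finset.univ) (t := fun i ↦ Finset.Ioi i) (by simp)
    (f := fun a ↦ Z s(a.1, a.2) ω * kernel n p (X a.1 ω) (X a.2 ω)),
    show (n : ℝ) * p * mu n p * ∑ i, (1 / (X i ω + 1) - mu n p) =
      p * mu n p * (n * ∑ i, (1 / (X i ω + 1) - mu n p)) by ring, ← h, Finset.mul_sum,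
    ← Finset.sum_add_distrib]
  refine Finset.sum_congr rfl fun a _ ↦ ?_
  rw [kernel_eq]
  ring

variable {Ω : Type*} [MeasurableSpace Ω] {P : Measure Ω} {n : ℕ} {p : unitInterval}
  {X : Fin (n + 1) → Ω → ℝ} {Z : Sym2 (Fin (n + 1)) → Ω → ℝ}

lemma measurable_V (hX_meas : ∀ i, Measurable (X i)) (hZ_meas : ∀ e, Measurable (Z e)) :
    Measurable (V n p X Z) := by
  unfold V kernel
  fun_prop

lemma isCenteredArray (hX_meas : ∀ i, Measurable (X i)) (hZ_meas : ∀ e, Measurable (Z e))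
    (hX_law : ∀ i, HasLaw (X i) Bin(ℝ, n - 1, p) P)
    (hZ_law : ∀ e, ¬ e.IsDiag → HasLaw (Z e) Ber(1, 0, p) P)
    (hindep : iIndepFun
      (Sum.elim X (fun e : {e : Sym2 (Fin (n + 1)) // ¬ e.IsDiag} ↦ Z e)) P) :
    IsCenteredArray P (fun i ω ↦ 1 / (X i ω + 1) - mu n p) Z (sigmaSq n p) p where
  indep := by
    have h := hindep.comp (fun a x ↦ Sum.elim (fun _ ↦ 1 / (x + 1) - mu n p) (fun _ ↦ x) a)
      (fun a ↦ by cases a <;> simp only [Sum.elim_inl, Sum.elim_inr] <;> fun_prop)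
    convert h using 1
    ext a ω
    cases a <;> rfl
  measurable_vertex i := by fun_prop
  measurable_edge := hZ_meas
  memLp_vertex i := by
    refine memLp_top_of_bound (Measurable.aestronglyMeasurable (by fun_prop)) 1 ?_
    have h := ((hX_law i).ae_iff (p := fun x ↦ 0 ≤ x)
      (measurableSet_setOfPred.1 measurableSet_Ici)).2 (ae_binomial_nonneg _ p)
    filter_upwards [h] with ω hω using abs_centered_inv_le_one hω
  integral_vertex i :=
    ((hX_law i).integral_comp (f := fun x ↦ 1 / (x + 1) - mu n p)
      (integrable_map_cast_binomial _).aestronglyMeasurable).trans (integral_centered_inv n p)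
  integral_vertex_sq i :=
    (hX_law i).integral_comp (f := fun x ↦ (1 / (x + 1) - mu n p) ^ 2)
      (integrable_map_cast_binomial _).aestronglyMeasurable
  edge_eq e he := by
    refine ((hZ_law e he).ae_iff (p := fun x ↦ x = 0 ∨ x = 1)
      (measurableSet_setOfPred.1 ((measurableSet_singleton 0).union
        (measurableSet_singleton 1)))).2 ?_
    rw [bernoulliMeasure_def, ae_add_measure_iff]
    refine ⟨Measure.ae_smul_measure ?_ _, Measure.ae_smul_measure ?_ _⟩ <;> simp [ae_dirac_eq]
  integral_edge e he := by
    rw [(hZ_law e he).integral_eq, integral_bernoulliMeasure]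
    simp

lemma charFun_map_sum_eq (hX_meas : ∀ i, Measurable (X i))
    (hX_law : ∀ i, HasLaw (X i) Bin(ℝ, n - 1, p) P) (hindep : iIndepFun X P) (c t : ℝ) :
    charFun (P.map fun ω ↦ c⁻¹ * ∑ i, (1 / (X i ω + 1) - mu n p)) t =
      charFun (Measure.map (fun x : ℝ ↦ 1 / (x + 1) - mu n p) Bin(ℝ, n - 1, p)) (t / c) ^
        (n + 1) := by
  have h1 := hindep.comp (fun _ x ↦ 1 / (x + 1) - mu n p) (fun _ ↦ by fun_prop)
  have h2 := h1.charFun_map_fun_sum_eq_prod (fun i ↦ by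
    exact Measurable.aemeasurable (by fun_prop))
  rw [charFun_map_mul_comp (Measurable.aemeasurable (by fun_prop)), div_eq_inv_mul]
  have h3 := congrFun h2 (c⁻¹ * t)
  refine h3.trans ?_
  rw [Finset.prod_apply, Finset.prod_congr rfl (g := fun _ ↦ charFun (Measure.map
    (fun x : ℝ ↦ 1 / (x + 1) - mu n p) Bin(ℝ, n - 1, p)) (c⁻¹ * t)), Finset.prod_const,
    Finset.card_univ, Fintype.card_fin]
  intro i _
  rw [← (hX_law i).map_eq, Measure.map_map (by fun_prop) (hX_meas i)]

variable [IsProbabilityMeasure P]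

lemma gammaSq_eq (hn : 1 ≤ n) (hX_meas : ∀ i, Measurable (X i)) (hZ_meas : ∀ e, Measurable (Z e))
    (hX_law : ∀ i, HasLaw (X i) Bin(ℝ, n - 1, p) P)
    (hZ_law : ∀ e, ¬ e.IsDiag → HasLaw (Z e) Ber(1, 0, p) P)
    (hindep : iIndepFun
      (Sum.elim X (fun e : {e : Sym2 (Fin (n + 1)) // ¬ e.IsDiag} ↦ Z e)) P) :
    gammaSq P n p X Z = mu n p ^ 2 * (p * sigmaSq n p) := by
  have h := isCenteredArray hX_meas hZ_meas hX_law hZ_law hindep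
  set D : Fin (n + 1) → Ω → ℝ := fun i ω ↦ 1 / (X i ω + 1) - mu n p with hD
  have h01 : (0 : Fin (n + 1)) ≠ 1 := by
    rw [Ne, Fin.ext_iff, Fin.val_zero, Fin.val_one']
    rw [Nat.mod_eq_of_lt (by omega)]
    omega
  have he : ¬ s((0 : Fin (n + 1)), 1).IsDiag := by simpa using h01
  have hpair : Measurable[MeasurableSpace.comap (fun ω ↦ (X 0 ω, Z s(0, 1) ω)) inferInstance]
    (fun ω ↦ (X 0 ω, Z s(0, 1) ω)) := comap_measurable _
  have hX0 : Measurable[MeasurableSpace.comap (fun ω ↦ (X 0 ω, Z s(0, 1) ω)) inferInstance]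
    (X 0) := measurable_fst.comp hpair
  have hZ0 : Measurable[MeasurableSpace.comap (fun ω ↦ (X 0 ω, Z s(0, 1) ω)) inferInstance]
    (Z s(0, 1)) := measurable_snd.comp hpair
  have hind : IndepFun (X 1) (fun ω ↦ (X 0 ω, Z s(0, 1) ω)) P := by
    have := hindep.indepFun_prodMk (by
      rintro (i | e)
      · exact hX_meas i
      · exact hZ_meas e) (Sum.inl 0) (Sum.inr ⟨s(0, 1), he⟩) (Sum.inl 1)
      (by simpa using h01) (by simp)
    exact this.symm
  have mY0 : MemLp (fun ω ↦ Z s(0, 1) ω * (1 / (X 0 ω + 1))) ⊤ P := by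
    have := memLp_top_mul (h.memLp_edge he) ((h.memLp_vertex 0).add (memLp_const (mu n p)))
    simpa [D] using this
  -- With `1/(X_0 + 1) = μ + D_0`, the kernel is `μ D_0 + (μ + D_0) D_1`; conditioning kills the
  -- term in `D_1`, which is centered and independent of `(X_0, Z_01)`.
  have hΦ : Phi n p X Z 0 1 = (fun ω ↦ mu n p * (Z s(0, 1) ω * D 0 ω)) +
      (fun ω ↦ Z s(0, 1) ω * (1 / (X 0 ω + 1))) * D 1 := by
    ext ω
    simp only [Phi, kernel_eq, D, Pi.add_apply, Pi.mul_apply]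
    ring
  have hΨ : Psi P n p X Z 1 0 =ᵐ[P] fun ω ↦ mu n p * (Z s(0, 1) ω * D 0 ω) := by
    rw [Psi, hΦ]
    exact condExp_add_mul_of_indep ((hX_meas 0).prodMk (hZ_meas s(0, 1))).comap_le
      (hX_meas 1).comap_le hind
      ((hZ0.mul ((measurable_const.div (hX0.add_const 1)).sub_const _)).const_mul _)
      (hZ0.mul (measurable_const.div (hX0.add_const 1)))
      ((measurable_const.div ((comap_measurable (X 1)).add_const 1)).sub_const _)
      (((memLp_top_mul (h.memLp_edge he) (h.memLp_vertex 0)).integrable le_top).const_mul _)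
      ((memLp_top_mul mY0 (h.memLp_vertex 1)).integrable le_top)
      ((h.memLp_vertex 1).integrable le_top) (h.integral_vertex 1)
  have e1 := h.integral_edge_mul_vertices he 0 1 (φ := fun x ↦ x ^ 2) (by fun_prop)
    (ψ := fun x ↦ x.1 ^ 2) (by fun_prop)
  simp only [h.integral_edge_sq he, h.integral_vertex_sq] at e1
  rw [gammaSq, ← e1, ← integral_const_mul]
  refine integral_congr_ae ?_
  filter_upwards [hΨ] with ω hω
  rw [hω]
  ring

lemma betaSq_le (hn : 1 ≤ n) (hX_meas : ∀ i, Measurable (X i)) (hZ_meas : ∀ e, Measurable (Z e))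
    (hX_law : ∀ i, HasLaw (X i) Bin(ℝ, n - 1, p) P)
    (hZ_law : ∀ e, ¬ e.IsDiag → HasLaw (Z e) Ber(1, 0, p) P)
    (hindep : iIndepFun
      (Sum.elim X (fun e : {e : Sym2 (Fin (n + 1)) // ¬ e.IsDiag} ↦ Z e)) P) :
    betaSq P n p X Z ≤ p * (4 * mu n p ^ 2 * sigmaSq n p + 2 * sigmaSq n p ^ 2) := by
  have h := isCenteredArray hX_meas hZ_meas hX_law hZ_law hindep
  have h01 : (0 : Fin (n + 1)) ≠ 1 := by
    rw [Ne, Fin.ext_iff, Fin.val_zero, Fin.val_one']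
    rw [Nat.mod_eq_of_lt (by omega)]
    omega
  simp only [betaSq, Phi, kernel_eq]
  exact h.integral_kernel_sq_le h01 (mu n p)

/-- The normalized statistic is close in mean to the normalized sum of its linear parts. -/
lemma integral_abs_V_div_sub_le (hn : 1 ≤ n) (hr : 1 ≤ (n : ℝ) * p) (hs : 0 < sigmaSq n p)
    (hX_meas : ∀ i, Measurable (X i)) (hZ_meas : ∀ e, Measurable (Z e))
    (hX_law : ∀ i, HasLaw (X i) Bin(ℝ, n - 1, p) P)
    (hZ_law : ∀ e, ¬ e.IsDiag → HasLaw (Z e) Ber(1, 0, p) P)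
    (hindep : iIndepFun
      (Sum.elim X (fun e : {e : Sym2 (Fin (n + 1)) // ¬ e.IsDiag} ↦ Z e)) P) :
    Integrable (fun ω ↦ V n p X Z ω / (n * theta P n p X Z) -
      (√(n * sigmaSq n p))⁻¹ * ∑ i, (1 / (X i ω + 1) - mu n p)) P ∧
    ∫ ω, |V n p X Z ω / (n * theta P n p X Z) -
      (√(n * sigmaSq n p))⁻¹ * ∑ i, (1 / (X i ω + 1) - mu n p)| ∂P ≤ 61 / √(n * p) := by
  have h := isCenteredArray hX_meas hZ_meas hX_law hZ_law hindep
  set D : Fin (n + 1) → Ω → ℝ := fun i ω ↦ 1 / (X i ω + 1) - mu n p with hD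
  set s := sigmaSq n p with hs_def
  set μ := mu n p with hμ_def
  set r : ℝ := n * p with hr_def
  set Q : Finset (Fin (n + 1) × Fin (n + 1)) := {a | a.1 < a.2} with hQ_def
  set R : Ω → ℝ := fun ω ↦ ∑ a ∈ Q, (μ * ((D a.1 ω + D a.2 ω) * (Z s(a.1, a.2) ω - p)) +
    Z s(a.1, a.2) ω * (D a.1 ω * D a.2 ω)) with hR_def
  set S : Ω → ℝ := fun ω ↦ (√(n * s))⁻¹ * ∑ i, D i ω with hS_def
  have hQ : ∀ a ∈ Q, a.1 < a.2 := fun a ha ↦ by simpa [Q] using ha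
  have hn0 : (0 : ℝ) < n := by exact_mod_cast hn
  have hn1 : (1 : ℝ) ≤ n := by exact_mod_cast hn
  have hr0 : 0 < r := by linarith
  have hp0 : 0 < (p : ℝ) := by
    by_contra hcon
    have : (p : ℝ) = 0 := le_antisymm (not_lt.1 hcon) p.2.1
    rw [hr_def, this] at hr0
    simp at hr0
  have hμ0 : 0 < μ := lt_of_lt_of_le (by positivity) (mu_ge hn hr)
  have hsμ : s ≤ 8 * μ ^ 2 := sigmaSq_le_mu_sq hn hp0 hr
  -- Chosen so that the linear part of `V` is `n * κ * S`; also `κ² = npγ²`.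
  set κ : ℝ := p * μ * √(n * s) with hκ_def
  set θ := theta P n p X Z with hθ_def
  have hκ0 : 0 < κ := by positivity
  have hκ2 : κ ^ 2 = p * r * μ ^ 2 * s := by
    rw [hκ_def, mul_pow, Real.sq_sqrt (by positivity), hr_def]
    ring
  -- `20 = 4 + 2·8`, from `s ≤ 8μ²`.
  have hmix : p * (4 * μ ^ 2 * s + 2 * s ^ 2) ≤ 20 * (κ ^ 2 / r) := by
    rw [hκ2, show 20 * (p * r * μ ^ 2 * s / r) = p * (20 * μ ^ 2 * s) by field_simp]
    refine mul_le_mul_of_nonneg_left ?_ hp0.le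
    nlinarith
  have hβ := betaSq_le hn hX_meas hZ_meas hX_law hZ_law hindep
  have hβ0 : 0 ≤ betaSq P n p X Z := integral_nonneg fun ω ↦ sq_nonneg _
  have hθ2 : θ ^ 2 = κ ^ 2 + betaSq P n p X Z / 2 := by
    have : (n : ℝ) * p * gammaSq P n p X Z = κ ^ 2 := by
      rw [gammaSq_eq hn hX_meas hZ_meas hX_law hZ_law hindep, hκ2]
      ring
    rw [hθ_def, theta, this, Real.sq_sqrt (by positivity)]
  have hθ_nonneg : 0 ≤ θ := Real.sqrt_nonneg _
  have hκθ : κ ≤ θ := by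
    refine le_of_sq_le_sq ?_ hθ_nonneg
    linarith
  have hθ0 : 0 < θ := hκ0.trans_le hκθ
  have hratio : |κ / θ - 1| ≤ 10 / r := abs_div_sub_one_le hκ0 hκθ hr0 hθ2 (hβ.trans hmix)
  have hV : ∀ ω, V n p X Z ω / (n * θ) - S ω = (κ / θ - 1) * S ω + (n * θ)⁻¹ * R ω := by
    intro ω
    have h1 : κ * S ω = p * μ * ∑ i, D i ω := by
      have : √(n * s) ≠ 0 := by positivity
      rw [hκ_def, hS_def]
      field_simp
    have h2 : V n p X Z ω = n * (κ * S ω) + R ω := by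
      rw [h1, V_eq]
      simp only [hR_def, hD]
      ring
    rw [h2]
    field_simp
    ring
  have mD : MemLp (fun ω ↦ ∑ i, D i ω) ⊤ P := memLp_finsetSum _ fun i _ ↦ h.memLp_vertex i
  have mS : MemLp S ⊤ P := mD.const_mul _
  have mR : MemLp R ⊤ P := memLp_finsetSum Q fun a ha ↦ by
    have he : ¬ s(a.1, a.2).IsDiag := by simpa using (hQ a ha).ne
    exact ((memLp_top_mul ((h.memLp_vertex _).add (h.memLp_vertex _))
      ((h.memLp_edge he).sub (memLp_const (p : ℝ)))).const_mul μ).add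
      (memLp_top_mul (h.memLp_edge he) (memLp_top_mul (h.memLp_vertex _) (h.memLp_vertex _)))
  have iS : Integrable S P := mS.integrable le_top
  have iR : Integrable R P := mR.integrable le_top
  have iS2 : Integrable (fun ω ↦ S ω ^ 2) P := (memLp_top_pow mS 2).integrable le_top
  have iR2 : Integrable (fun ω ↦ R ω ^ 2) P := (memLp_top_pow mR 2).integrable le_top
  have hS2 : ∫ ω, S ω ^ 2 ∂P ≤ 2 := by
    have e1 := integral_sum_sq_of_orthogonal (P := P) Finset.univ D
      (fun a _ b _ ↦ (memLp_top_mul (h.memLp_vertex a) (h.memLp_vertex b)).integrable le_top)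
      (fun a _ b _ hab ↦ h.integral_vertex_mul hab)
    simp only [h.integral_vertex_sq, Finset.sum_const, Finset.card_univ, Fintype.card_fin,
      nsmul_eq_mul] at e1
    simp only [hS_def, mul_pow]
    rw [integral_const_mul, e1, inv_pow, Real.sq_sqrt (by positivity), inv_mul_le_iff₀
      (by positivity)]
    push_cast
    nlinarith
  have hR2 : ∫ ω, R ω ^ 2 ∂P ≤ 80 * (n * κ) ^ 2 / r := by
    have hcard : (Q.card : ℝ) ≤ 4 * n ^ 2 := by
      have h1 : (Q.card : ℝ) ≤ (n + 1) ^ 2 := by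
        have := Finset.card_le_univ Q
        rw [Fintype.card_prod, Fintype.card_fin, ← sq] at this
        exact_mod_cast this
      nlinarith
    calc ∫ ω, R ω ^ 2 ∂P ≤ Q.card * (p * (4 * μ ^ 2 * s + 2 * s ^ 2)) :=
          h.integral_remainder_sq_le Q hQ μ
      _ ≤ (4 * n ^ 2) * (20 * (κ ^ 2 / r)) := by gcongr
      _ = _ := by ring
  have hSabs : ∫ ω, |S ω| ∂P ≤ 2 := by
    have := integral_abs_le_of_sq iS iS2 one_pos
    linarith
  have hsqrt0 : 0 < √r := Real.sqrt_pos.2 hr0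
  have hRabs : ∫ ω, |R ω| ∂P ≤ 41 * (n * κ) / √r := by
    have hnκ : 0 < n * κ := by positivity
    -- With this weight the bound is `(1 + 80)/2 ≤ 41` times `nκ/√r`.
    have e1 := integral_abs_le_of_sq iR iR2 (a := n * κ / √r) (by positivity)
    have e2 : (∫ ω, R ω ^ 2 ∂P) / (n * κ / √r) ≤ 80 * (n * κ / √r) := by
      calc (∫ ω, R ω ^ 2 ∂P) / (n * κ / √r) ≤ 80 * (n * κ) ^ 2 / r / (n * κ / √r) := by gcongr
        _ = 80 * (n * κ) * (√r / r) := by field_simp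
        _ = 80 * (n * κ / √r) := by
          rw [Real.sqrt_div_self']
          ring
    have e3 : 0 ≤ n * κ / √r := by positivity
    have e4 : 41 * (n * κ) / √r = 41 * (n * κ / √r) := by ring
    linarith
  have iV : Integrable (fun ω ↦ (κ / θ - 1) * S ω + (n * θ)⁻¹ * R ω) P :=
    (iS.const_mul _).add (iR.const_mul _)
  change Integrable (fun ω ↦ V n p X Z ω / (n * θ) - S ω) P ∧
    ∫ ω, |V n p X Z ω / (n * θ) - S ω| ∂P ≤ _
  simp only [hV]
  refine ⟨iV, ?_⟩
  calc ∫ ω, |(κ / θ - 1) * S ω + (n * θ)⁻¹ * R ω| ∂P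
      ≤ ∫ ω, (|κ / θ - 1| * |S ω| + (n * θ)⁻¹ * |R ω|) ∂P := by
        refine integral_mono iV.abs ((iS.abs.const_mul _).add (iR.abs.const_mul _)) fun ω ↦ ?_
        dsimp only
        refine (abs_add_le _ _).trans_eq ?_
        rw [abs_mul _ (S ω), abs_mul _ (R ω), abs_of_nonneg (a := (n * θ)⁻¹) (by positivity)]
    _ = |κ / θ - 1| * ∫ ω, |S ω| ∂P + (n * θ)⁻¹ * ∫ ω, |R ω| ∂P := by
        rw [integral_add (iS.abs.const_mul _) (iR.abs.const_mul _), integral_const_mul,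
          integral_const_mul]
    _ ≤ 10 / r * 2 + (n * κ)⁻¹ * (41 * (n * κ) / √r) := by
        have : 0 ≤ ∫ ω, |S ω| ∂P := integral_nonneg fun ω ↦ abs_nonneg _
        gcongr
    _ = 20 / r + 41 / √r := by
        field_simp
        ring
    _ ≤ 20 / √r + 41 / √r := by
        have : √r ≤ r := by
          have : 1 ≤ √r := Real.one_le_sqrt.2 hr
          nlinarith [Real.mul_self_sqrt hr0.le]
        gcongr
    _ = 61 / √r := by ring

end Statistic

end RandomUStat

/-! ### The limit theorem. -/

theorem proposition5p5
    (p : ℕ → unitInterval)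
    (hp : ∀ n, 0 < (p n : ℝ) ∧ (p n : ℝ) < 1)
    (hp_log : Tendsto (fun n : ℕ ↦ (n : ℝ) * p n / Real.log n) atTop atTop)
    (hp_compl : Tendsto (fun n : ℕ ↦ (n : ℝ) * (1 - p n)) atTop atTop)
    {Ω : ℕ → Type*} [∀ n, MeasurableSpace (Ω n)]
    (P : (n : ℕ) → Measure (Ω n)) [∀ n, IsProbabilityMeasure (P n)]
    (X : (n : ℕ) → Fin (n + 1) → Ω n → ℝ)
    (Z : (n : ℕ) → Sym2 (Fin (n + 1)) → Ω n → ℝ)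
    (hX_meas : ∀ n i, Measurable (X n i))
    (hZ_meas : ∀ n e, Measurable (Z n e))
    (hX_law : ∀ n i, HasLaw (X n i) Bin(ℝ, n - 1, p n) (P n))
    (hZ_law : ∀ n e, ¬ e.IsDiag → HasLaw (Z n e) Ber(1, 0, p n) (P n))
    (hindep : ∀ n, iIndepFun
      (Sum.elim (X n) (fun e : {e : Sym2 (Fin (n + 1)) // ¬ e.IsDiag} ↦ Z n e)) (P n)) :
    TendstoInDistribution
      (fun (n : ℕ) (ω : Ω n) ↦ RandomUStat.V n (p n) (X n) (Z n) ω /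
        (n * RandomUStat.theta (P n) n (p n) (X n) (Z n)))
      atTop (id : ℝ → ℝ) P (gaussianReal 0 1) := by
  have hr : Tendsto (fun n : ℕ ↦ (n : ℝ) * p n) atTop atTop := by
    refine tendsto_atTop_mono' atTop ?_ hp_log
    filter_upwards [eventually_ge_atTop 3] with n hn
    refine div_le_self (mul_nonneg (Nat.cast_nonneg n) (p n).2.1) ?_
    have h3 : (3 : ℝ) ≤ n := by exact_mod_cast hn
    rw [Real.le_log_iff_exp_le (by linarith)]
    linarith [Real.exp_one_lt_d9]
  have hgood : ∀ᶠ n : ℕ in atTop, 1 ≤ n ∧ 1 ≤ (n : ℝ) * p n ∧ 3 ≤ ((n - 1 : ℕ) : ℝ) * p n ∧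
      1 ≤ (n : ℝ) * p n * (1 - p n) := by
    filter_upwards [eventually_ge_atTop 1, hr.eventually_ge_atTop 4,
      hp_compl.eventually_ge_atTop 4] with n hn h1 h2
    refine ⟨hn, by linarith, ?_, ?_⟩
    · rw [Nat.cast_sub hn]
      push_cast
      linarith [(hp n).2]
    -- One of `p`, `1 - p` is at least 1/2, and `n` times the other is at least 4.
    · rcases le_total (1 / 2 : ℝ) (p n) with h | h <;> nlinarith
  have hs : ∀ᶠ n : ℕ in atTop, 0 < RandomUStat.sigmaSq n (p n) := by
    filter_upwards [hgood] with n hn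
    refine lt_of_lt_of_le ?_ (RandomUStat.le_sigmaSq hn.1 (hp n).2 hn.2.2.1)
    have : 0 < 1 - (p n : ℝ) := sub_pos.2 (hp n).2
    have := hn.2.1
    positivity
  set ν : ℕ → Measure ℝ := fun n ↦ Measure.map (fun x : ℝ ↦ 1 / (x + 1) - RandomUStat.mu n (p n))
    Bin(ℝ, n - 1, p n) with hν
  have hf : ∀ n, Measurable (fun x : ℝ ↦ 1 / (x + 1) - RandomUStat.mu n (p n)) := fun n ↦ by
    fun_prop
  have hνprob : ∀ n, IsProbabilityMeasure (ν n) := fun n ↦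
    Measure.isProbabilityMeasure_map (hf n).aemeasurable
  have hmom : ∀ n k, ∫ x, x ^ k ∂ν n =
      ∫ x : ℝ, (1 / (x + 1) - RandomUStat.mu n (p n)) ^ k ∂Bin(ℝ, n - 1, p n) := fun n k ↦
    integral_map (hf n).aemeasurable (Measurable.aestronglyMeasurable (by fun_prop))
  have hclt : ∀ t : ℝ, Tendsto (fun n : ℕ ↦ charFun (ν n)
      (t / √(n * RandomUStat.sigmaSq n (p n))) ^ (n + 1)) atTop
      (𝓝 (Complex.exp (-t ^ 2 / 2))) := by
    intro t
    have h2 : ∀ n, RandomUStat.sigmaSq n (p n) = ∫ x, x ^ 2 ∂ν n := fun n ↦ (hmom n 2).symm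
    simp_rw [h2]
    refine RandomUStat.tendsto_charFun_pow_of_pow_four_le (C := 16 * 10 ^ 6) (fun n ↦ ?_)
      (fun n ↦ ?_) (by simpa only [h2] using hs) ?_ t
    · rw [memLp_map_measure_iff aestronglyMeasurable_id (hf n).aemeasurable]
      refine MemLp.mono_exponent (q := ⊤) ?_ le_top
      refine memLp_top_of_bound (hf n).aestronglyMeasurable 1 ?_
      filter_upwards [RandomUStat.ae_binomial_nonneg _ (p n)] with x hx
      exact RandomUStat.abs_centered_inv_le_one hx
    · have := hmom n 1
      simp only [pow_one] at this
      rw [this, RandomUStat.integral_centered_inv]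
    · filter_upwards [hgood] with n hn
      rw [hmom, ← h2]
      exact RandomUStat.integral_centered_inv_pow_four_le_sigmaSq hn.1 (hp n).1 (hp n).2
        hn.2.2.1 hn.2.2.2
  have hVm : ∀ n, Measurable (fun ω : Ω n ↦ RandomUStat.V n (p n) (X n) (Z n) ω /
      (n * RandomUStat.theta (P n) n (p n) (X n) (Z n))) := fun n ↦
    (RandomUStat.measurable_V (hX_meas n) (hZ_meas n)).div_const _
  refine ⟨fun n ↦ (hVm n).aemeasurable, aemeasurable_id, ?_⟩
  refine ProbabilityMeasure.tendsto_iff_tendsto_charFun.2 fun t ↦ ?_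
  simp only [ProbabilityMeasure.coe_mk, Measure.map_id]
  have hlim : charFun (gaussianReal 0 1) t = Complex.exp (-t ^ 2 / 2) := by
    simp [charFun_gaussianReal, neg_div]
  rw [hlim]
  have hdiff : Tendsto (fun n : ℕ ↦ charFun ((P n).map fun ω ↦
      RandomUStat.V n (p n) (X n) (Z n) ω / (n * RandomUStat.theta (P n) n (p n) (X n) (Z n))) t -
      charFun (ν n) (t / √(n * RandomUStat.sigmaSq n (p n))) ^ (n + 1)) atTop (𝓝 0) := by
    have h0 : Tendsto (fun n : ℕ ↦ |t| * (61 / √((n : ℝ) * p n))) atTop (𝓝 0) := by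
      have := ((tendsto_const_nhds (x := (61 : ℝ))).div_atTop
        (Real.tendsto_sqrt_atTop.comp hr)).const_mul |t|
      simpa using this
    refine squeeze_zero_norm' ?_ h0
    filter_upwards [hgood, hs] with n hn hsn
    obtain ⟨i1, i2⟩ := RandomUStat.integral_abs_V_div_sub_le hn.1 hn.2.1 hsn (hX_meas n)
      (hZ_meas n) (hX_law n) (hZ_law n) (hindep n)
    have hX_indep : iIndepFun (X n) (P n) :=
      iIndepFun.precomp (g := Sum.inl) Sum.inl_injective (hindep n)
    rw [← RandomUStat.charFun_map_sum_eq (hX_meas n) (hX_law n) hX_indep]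
    have hXn := hX_meas n
    refine (RandomUStat.norm_charFun_map_sub_le (hVm n).aemeasurable
      (Measurable.aemeasurable (by fun_prop)) i1 t).trans ?_
    gcongr
  simpa using hdiff.add (hclt t)
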